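/- **Modular links and full bunches.** Let $L$ be a modular link with $c$ components, given by its labelled code words $$w_r = x_{r,1}^{k_{r,1}} y_{r,1}^{l_{r,1}} \cdots x_{r,n_r}^{k_{r,n_r}} y_{r,n_r}^{l_{r,n_r}},\qquad 1\le r\le c,$$ with $n_r \ge 1$ and all exponents positive. The words are primitive, and no two of them agree up to cyclic permutation. Let $\overline n=\sum_r n_r$ be the sum of the word periods. Write $i$ for a subscript $(r,j)$, and $i+1$ for the cyclically next subscript in the same word. Embed $L$ in the Lorenz template. The turn of a letter starts at the point of the branch line whose orbit reads the periodic word from that letter on; equivalently, with the branch line identified with $[0,1]$, at the number whose binary digits are these letters, with $x\mapsto 0$, $y\mapsto 1$. The $\overline n$ turns of the last letters of the subwords $x_i^{k_i}$, listed from left to right, give the order $(x_{\sigma(1)},\dots,x_{\sigma(\overline n)})$ within the full $x$-bunch. The turns of the last letters of the subwords $y_i^{l_i}$ give the order $(y_{\tau(1)},\dots,y_{\tau(\overline n)})$ within the full $y$-bunch in the same way. **The Seifert-fibred space.** Let $U=\{z_1=0\}\subset \mathbb S^3=\{|z_1|^2+|z_2|^2=1\}$. This is an unknot bounding the disc $\{z_1>0\}$,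 which $z_2$ identifies with the open unit disc $D$. The complement of $U$ is fibred over $D$ by the pairwise unlinked circles $z_2=\mathrm{const}$. In $D$ take pairwise disjoint vertical segments, from left to right: one for each distinct $x$-exponent $d$, in descending order of $d$, and then one for each distinct $y$-exponent $a$, in ascending order of $a$. The annuli $A^x_d$, $A^y_a$ are the unions of the fibres over these segments. Let $\mathcal L_{\mathrm{SF}}$ be the union of $U$ and all boundary components of the annuli, $M=\mathbb S^3\setminus\mathcal L_{\mathrm{SF}}$, and let $\mathcal P\colon M\to B$, $\mathcal P(z_1,z_2)=z_2$, be the bundle projection onto the punctured disc $B$, that is, $D$ without the end points of the segments. **The parent link.** The parent link $L_{\mathrm p}\subset M$ of $L$ is defined up to ambient isotopy in $M$ by the following diagram in $B$. * Draw $\overline n$ horizontal $y$-segments, labelled $y_{\tau(1)},\dots,y_{\tau(\overline n)}$ from top to bottom. Below them draw $\overline n$ horizontal $x$-segments, labelled $x_{\sigma(1)},\dots,x_{\sigma(\overline n)}$ from bottom to top. * To the left, the $x_i$-segment crosses exactly the annuli $A^x_d$ with $d\le k_i$, once each, and ends before the next one; the $y$-segments pass above all $x$-annuli. To the right, the $y_i$-segment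 crosses exactly the annuli $A^y_a$ with $a\le l_i$, once each, and ends before the next one; the $x$-segments pass below all $y$-annuli. * For each $i$, a vertical segment (the vertical $x_i$-segment) joins the right ends of the $x_i$-segment and the $y_i$-segment, and a vertical segment (the vertical $y_i$-segment) joins the left ends of the $y_i$-segment and the $x_{i+1}$-segment. * The $x_i$-arc (or $y_i$-arc) is the union of the horizontal and the vertical segment of that label. The horizontal extensions are chosen so that $x$-arcs whose vertical segments approach the same $y$-annulus (equal exponents $l_i$) do not intersect each other, and $y$-arcs whose vertical segments approach the same $x$-annulus (equal exponents $k_{i+1}$) do not intersect each other. * At crossings, every $y$-arc passes under every $x$-arc, and every vertical $x$-segment passes under every horizontal $x$-segment. **Statement.** The parent link $L_{\mathrm p}$ can be ambient-isotoped in $M$ to a position in which $\mathcal P(L_{\mathrm p})$ is a collection of piecewise smooth loops that intersect themselves and each other only transversely and finitely many times, with exactly two preimage points in $L_{\mathrm p}$ for each self-intersection point, and in which the number of self-intersections of $\mathcal P(L_{\mathrm p})$ is at most $\frac32\,\overline n(\overline n-1)$. -/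

import Mathlib

open scoped ContDiff

noncomputable section

/-! ## Labelled code words -/

/-- The two letters of a code word. -/
inductive Letter where
  | x : Letter
  | y : Letter

/-- The letter `x` is read as the binary digit `0`, the letter `y` as the binary digit `1`. -/
def Letter.digit : Letter → ℝ
  | .x => 0
  | .y => 1

/-- A word is primitive (aperiodic) if it is not a power `u ^ m` with `m ≠ 1`. -/
def IsPrimitiveWord (w : List Letter) : Prop :=
  ∀ (u : List Letter) (m : ℕ), w = (List.replicate m u).flatten → m = 1

/-- The exponents of `c` labelled code words
`w_r = x_{r,0}^{k r 0} y_{r,0}^{l r 0} ⋯ x_{r,n r - 1}^{k r (n r - 1)} y_{r,n r - 1}^{l r (n r - 1)}`.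
The subscripts of the bases of the word `w_r` of period `n r` live in the cyclic group
`ZMod (n r)`. -/
structure CodeWords where
  c : ℕ
  n : Fin c → ℕ
  [n_ne : ∀ r, NeZero (n r)]
  k : ∀ r : Fin c, ZMod (n r) → ℕ
  l : ∀ r : Fin c, ZMod (n r) → ℕ
  k_pos : ∀ r i, 0 < k r i
  l_pos : ∀ r i, 0 < l r i

attribute [instance] CodeWords.n_ne

namespace CodeWords

/-- The word `w_r`, as a list of letters. -/
def codeWord (W : CodeWords) (r : Fin W.c) : List Letter :=
  (List.ofFn fun j : Fin (W.n r) =>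
    List.replicate (W.k r ((j : ℕ) : ZMod (W.n r))) Letter.x ++
      List.replicate (W.l r ((j : ℕ) : ZMod (W.n r))) Letter.y).flatten

end CodeWords

/-- A modular link, given by its labelled code words: a finite family of primitive words, each of
them containing both letters, no two of them equal up to cyclic permutation. -/
structure ModularLink extends CodeWords where
  primitive : ∀ r, IsPrimitiveWord (toCodeWords.codeWord r)
  distinct : ∀ r s, (toCodeWords.codeWord r).IsRotated (toCodeWords.codeWord s) → r = s

namespace CodeWords

variable (W : CodeWords)

/-- The set of all subscripts `i` of bases `x_i` (equivalently, of bases `y_i`), over all words. -/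
abbrev Index : Type := Σ r : Fin W.c, ZMod (W.n r)

/-- The sum of all word periods. -/
def nbar : ℕ := ∑ r, W.n r

/-! ## The link in the Lorenz template, and the orders within the full bunches -/

/-- The letter of the bi-infinite periodic word `⋯ w_r w_r w_r ⋯` with number `m`, where the letters
of `w_r` are numbered from `0`. -/
def letterAt (r : Fin W.c) (m : ℕ) : Letter :=
  (W.codeWord r).getD (m % (W.codeWord r).length) Letter.x

/-- The starting point, on the branch line, of the turn of the link that corresponds to the letter
number `m` of `w_r`. The branch line of the Lorenz template is `[0, 1]`, drawn from left to right,
the mark that separates the start points of `x`-turns from those of `y`-turns is `1 / 2`, and the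
first return map of the semiflow of the template is `u ↦ 2 u` on the left of the mark and
`u ↦ 2 u - 1` on the right of it. So the point whose orbit reads the letters
`letterAt r m, letterAt r (m + 1), …` is the one with these binary digits. -/
def branchPoint (r : Fin W.c) (m : ℕ) : ℝ :=
  ∑' t : ℕ, (W.letterAt r (m + t)).digit / 2 ^ (t + 1)

/-- The number of letters of `w_r` that precede the subword `x_i ^ k_i y_i ^ l_i`. -/
def lettersBefore (i : W.Index) : ℕ :=
  ∑ j ∈ Finset.range i.2.val,
    (W.k i.1 (j : ZMod (W.n i.1)) + W.l i.1 (j : ZMod (W.n i.1)))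

/-- The starting point of the `(x_i, k_i)`-turn, that is, of the turn of the last letter of the
subword `x_i ^ k_i`. These turns, one for each `x`-base, form the full `x`-bunch. -/
def xTurnStart (i : W.Index) : ℝ :=
  W.branchPoint i.1 (W.lettersBefore i + (W.k i.1 i.2 - 1))

/-- The starting point of the `(y_i, l_i)`-turn, that is, of the turn of the last letter of the
subword `y_i ^ l_i`. These turns, one for each `y`-base, form the full `y`-bunch. -/
def yTurnStart (i : W.Index) : ℝ :=
  W.branchPoint i.1 (W.lettersBefore i + W.k i.1 i.2 + (W.l i.1 i.2 - 1))

/-- The place (`1, …, nbar`) of `x_i` in the order within the full `x`-bunch, from left to right: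
if this order is `(x_{σ(1)}, …, x_{σ(nbar)})` then `xRank` is the inverse of `σ`. -/
def xRank (i : W.Index) : ℕ := {j : W.Index | W.xTurnStart j ≤ W.xTurnStart i}.ncard

/-- The place (`1, …, nbar`) of `y_i` in the order within the full `y`-bunch, from left to right:
if this order is `(y_{τ(1)}, …, y_{τ(nbar)})` then `yRank` is the inverse of `τ`. -/
def yRank (i : W.Index) : ℕ := {j : W.Index | W.yTurnStart j ≤ W.yTurnStart i}.ncard

/-! ## The Seifert-fibred space

The 3-sphere is the unit sphere of `ℂ²`. The unknot `U` is the circle `z₁ = 0`. It bounds the disc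
`z₁ > 0`, which `(z₁, z₂) ↦ z₂` identifies with the open unit disc; the circles `z₂ = const` in the
complement of `U` are unlinked, and each meets this disc once, perpendicularly. The disc is drawn
in the plane at scale `1 : scale`, with the left hole of the template on the left, and the front of
the template at the bottom. The annuli `A^x_d` and `A^y_a` are the preimages of disjoint vertical
segments in the disc:
* for each `x`-exponent `d`, the segment from `-d - (nbar + 1) i` to `-d`;
* for each `y`-exponent `a`, the segment from `a` to `a + (nbar + 1) i`. -/

/-- The number by which the drawing is divided in order to fit into the unit disc. -/
def scale : ℝ := (∑ i : W.Index, ((W.k i.1 i.2 : ℝ) + W.l i.1 i.2)) + W.nbar + 3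

/-- The end points, in the unit disc, of the segments over which the annuli lie. -/
def punctures : Set ℂ :=
  {z | ∃ i : W.Index,
    z = (⟨-(W.k i.1 i.2 : ℝ), 0⟩ : ℂ) / W.scale ∨
    z = (⟨-(W.k i.1 i.2 : ℝ), -((W.nbar : ℝ) + 1)⟩ : ℂ) / W.scale ∨
    z = (⟨(W.l i.1 i.2 : ℝ), 0⟩ : ℂ) / W.scale ∨
    z = (⟨(W.l i.1 i.2 : ℝ), (W.nbar : ℝ) + 1⟩ : ℂ) / W.scale}

end CodeWords

/-- The 3-sphere. -/
def ThreeSphere : Set (ℂ × ℂ) := {p | ‖p.1‖ ^ 2 + ‖p.2‖ ^ 2 = 1}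

/-- The unknot `U`. -/
def unknotU : Set (ℂ × ℂ) := {p ∈ ThreeSphere | p.1 = 0}

/-- The circle in the 3-sphere over the point `z` of the open unit disc. -/
def fibreOver (z : ℂ) : Set (ℂ × ℂ) := {p ∈ ThreeSphere | p.2 = z}

namespace CodeWords

variable (W : CodeWords)

/-- The link that consists of `U` and of all boundary components of the annuli. -/
def sfLink : Set (ℂ × ℂ) := unknotU ∪ ⋃ z ∈ W.punctures, fibreOver z

/-- The Seifert-fibred space of the modular link: the complement of `sfLink` in the 3-sphere. -/
abbrev SeifertSpace : Type := ↥(ThreeSphere \ W.sfLink)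

/-- The base: the open unit disc, bounded by `U`, without the punctures. -/
def base : Set ℂ := Metric.ball 0 1 \ W.punctures

theorem snd_mem_base (p : W.SeifertSpace) : (p : ℂ × ℂ).2 ∈ W.base := by
  obtain ⟨p, hp, hq⟩ := p
  have hp' : ‖p.1‖ ^ 2 + ‖p.2‖ ^ 2 = 1 := hp
  simp only [sfLink, Set.mem_union, not_or, Set.mem_iUnion, not_exists] at hq
  refine ⟨?_, fun h => hq.2 p.2 h ⟨hp, rfl⟩⟩
  have h1 : p.1 ≠ 0 := fun h => hq.1 ⟨hp, h⟩
  have h2 : 0 < ‖p.1‖ := norm_pos_iff.mpr h1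
  simp only [Metric.mem_ball, dist_zero_right]
  nlinarith [norm_nonneg p.2]

/-- The bundle projection of the Seifert-fibred space; its fibres are the circles `z₂ = const`. -/
def proj (p : W.SeifertSpace) : W.base := ⟨(p : ℂ × ℂ).2, W.snd_mem_base p⟩

/-! ## The parent link

The parent link is drawn in the disc. Its vertical segments are interpolated linearly in the
direction of the fibres: the horizontal `x_i`-segments have height `1`, the horizontal
`y_i`-segments have height `0`, and the height is linear on each vertical segment, so that at every
crossing each `y`-arc passes under each `x`-arc, and each vertical `x`-segment passes under each
horizontal `x`-segment. -/

/-- The level of the horizontal `x_i`-segment: `x_{σ(1)}, x_{σ(2)}, …` from bottom to top. -/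
def xLevel (i : W.Index) : ℝ := (W.xRank i : ℝ) - (W.nbar + 1)

/-- The level of the horizontal `y_i`-segment: `y_{τ(1)}, y_{τ(2)}, …` from top to bottom, all of
them above the `x`-segments. -/
def yLevel (i : W.Index) : ℝ := (W.nbar + 1) - (W.yRank i : ℝ)

/-- The abscissa of the left end of the `x_i`-segment: to the left of the annulus `A^x_{k_i}`, and
to the right of all annuli `A^x_d` with `d > k_i`. Among segments with the same exponent, a lower
one reaches further, so that arcs approaching the same annulus do not intersect. -/
def xLeft (i : W.Index) : ℝ :=
  -(W.k i.1 i.2 + ((W.nbar + 1) - (W.xRank i : ℝ)) / (W.nbar + 1))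

/-- The abscissa of the right ends of the `x_i`-segment and the `y_i`-segment: to the right of the
annulus `A^y_{l_i}`, and to the left of all annuli `A^y_a` with `a > l_i`. Among segments with the
same exponent, a lower `x_i`-segment reaches further, so that arcs approaching the same annulus do
not intersect. -/
def xRight (i : W.Index) : ℝ :=
  W.l i.1 i.2 + ((W.nbar + 1) - (W.xRank i : ℝ)) / (W.nbar + 1)

/-- The vertices (position in the plane, height) of the component of the parent link with word
`w_r`, in the order of the word: for each `i`, the left and the right end of the `x_i`-segment, then
the right and the left end of the `y_i`-segment, the latter being vertically above the left end of
the `x_{i+1}`-segment. -/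
def vertex (r : Fin W.c) (m : ℤ) : ℂ × ℝ :=
  let i : W.Index := ⟨r, ((m / 4 : ℤ) : ZMod (W.n r))⟩
  let i' : W.Index := ⟨r, ((m / 4 : ℤ) : ZMod (W.n r)) + 1⟩
  if m % 4 = 0 then (⟨W.xLeft i, W.xLevel i⟩, 1)
  else if m % 4 = 1 then (⟨W.xRight i, W.xLevel i⟩, 1)
  else if m % 4 = 2 then (⟨W.xRight i, W.yLevel i⟩, 0)
  else (⟨W.xLeft i', W.yLevel i⟩, 0)

/-- The closed polygon through the vertices, with period `1`. -/
def polygon (r : Fin W.c) (t : ℝ) : ℂ × ℝ :=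
  AffineMap.lineMap (W.vertex r ⌊4 * W.n r * t⌋) (W.vertex r (⌊4 * W.n r * t⌋ + 1))
    (Int.fract (4 * W.n r * t))

/-- The point of the 3-sphere at the given position (in the drawing) and height: the height is the
argument of `z₁`, measured from the disc bounded by `U`. -/
def lift (p : ℂ × ℝ) : ℂ × ℂ :=
  ((Real.sqrt (1 - ‖p.1 / W.scale‖ ^ 2) : ℂ) * Complex.exp (p.2 * Complex.I), p.1 / W.scale)

/-- The parent link, in the position in which it is constructed. -/
def parentLink : Set W.SeifertSpace :=
  {p | ∃ r t, (p : ℂ × ℂ) = W.lift (W.polygon r t)}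

/-! ## Links in the Seifert-fibred space and their projections -/

/-- `γ` parametrizes the link `K` with `c` components: each component by a closed curve of period
`1`, all curves being simple and pairwise disjoint. -/
structure IsLinkParam (γ : Fin W.c → ℝ → W.SeifertSpace) (K : Set W.SeifertSpace) : Prop where
  continuous : ∀ r, Continuous (γ r)
  periodic : ∀ r, Function.Periodic (γ r) 1
  injective : ∀ r s, ∀ t ∈ Set.Ico (0 : ℝ) 1, ∀ u ∈ Set.Ico (0 : ℝ) 1,
    γ r t = γ s u → r = s ∧ t = u
  range : K = ⋃ r, Set.range (γ r)

/-- The projection of the component `r`, as a curve in the plane. -/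
def projCurve (γ : Fin W.c → ℝ → W.SeifertSpace) (r : Fin W.c) (t : ℝ) : ℂ := W.proj (γ r t)

/-- The projection of the component `r` is a smooth immersion near the parameter `t`. -/
def IsImmersedAt (γ : Fin W.c → ℝ → W.SeifertSpace) (r : Fin W.c) (t : ℝ) : Prop :=
  ContDiffAt ℝ ∞ (W.projCurve γ r) t ∧ deriv (W.projCurve γ r) t ≠ 0

/-- The self-intersections of the projection of `K`: the points of the base over which there are at
least two points of `K`. -/
def selfIntersections (K : Set W.SeifertSpace) : Set W.base :=
  {b | ∃ p ∈ K, ∃ q ∈ K, p ≠ q ∧ W.proj p = b ∧ W.proj q = b}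

/-- The projection of the link `K`, parametrized by `γ`, is a collection of piecewise smooth loops
that intersect themselves and each other only transversely (and not in corners) and finitely many
times, with exactly two preimage points for each self-intersection point. -/
structure IsRegularProjection (γ : Fin W.c → ℝ → W.SeifertSpace) (K : Set W.SeifertSpace) :
    Prop where
  corners : ∀ r, {t ∈ Set.Ico (0 : ℝ) 1 | ¬ W.IsImmersedAt γ r t}.Finite
  transverse : ∀ r s t u, γ r t ≠ γ s u → W.proj (γ r t) = W.proj (γ s u) →
    W.IsImmersedAt γ r t ∧ W.IsImmersedAt γ s u ∧
      LinearIndependent ℝ ![deriv (W.projCurve γ r) t, deriv (W.projCurve γ s) u]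
  finite : (W.selfIntersections K).Finite
  double : ∀ b ∈ W.selfIntersections K, {p ∈ K | W.proj p = b}.encard = 2

end CodeWords

/-- There is an ambient isotopy of `X` that carries `K` to `K'`. -/
def AmbientIsotopic {X : Type*} [TopologicalSpace X] (K K' : Set X) : Prop :=
  ∃ H : unitInterval → X ≃ₜ X,
    Continuous (fun q : unitInterval × X => H q.1 q.2) ∧
      (∀ p, H 0 p = p) ∧ H 1 '' K = K'

end

noncomputable section

/-! ## Binary expansions of letter sequences -/

/-! The position in which the parent link is constructed already satisfies the bound, so the isotopy
is the given one run backwards (`AmbientIsotopic.symm`). What remains is to show that the drawing is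
regular and to count its crossings.

All sides are horizontal or vertical. Turns of different subscripts start at different points, since
equal binary values would give equal periodic words, against primitivity or distinctness of the
words (`eq_of_branchPoint_eq`). Hence all ranks differ, parallel sides lie on different lines or are
disjoint, and a double point is a horizontal side met by a vertical one. Both are met in their
interiors, where the heights differ, and a third preimage would be parallel to one of the two.

There are four kinds of pairs (`sidePoint_fst_crossing`). A vertical `x_i`-segment meets the
`x_j`-segment only if `x_i` has the smaller `x`-rank; a vertical `y`-segment ending at `x_i` meets
the `x_j`-segment under the same condition; a vertical `x_i`-segment meets the `y_j`-segment only if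
`y_i` has the smaller `y`-rank. Each kind contributes at most one crossing for each two-element set
of subscripts, hence at most `nbar * (nbar - 1) / 2`.

The fourth kind, vertical `y` against horizontal `y`, does not occur. The digits after the last `y`
of a subword are those of the next `x`-block, so a `y`-turn further left is followed by a larger
`x`-exponent, or by an equal one and an `x`-turn further left (`yTurnStart_lt`). Thus higher
`y`-segments reach further left (`xLeft_next_lt`), and their descending vertical segments pass
outside the lower ones. -/

theorem Letter.digit_nonneg (a : Letter) : 0 ≤ a.digit := by cases a <;> simp [Letter.digit]

theorem Letter.digit_le_one (a : Letter) : a.digit ≤ 1 := by cases a <;> simp [Letter.digit]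

/-- The number with the given binary digits. -/
def binaryValue (a : ℕ → Letter) : ℝ := ∑' t : ℕ, (a t).digit / 2 ^ (t + 1)

theorem summable_half_pow_succ : Summable fun t : ℕ => (1 : ℝ) / 2 ^ (t + 1) := by
  have := (summable_nat_add_iff 1).mpr summable_geometric_two
  simpa using this

theorem summable_binaryValue (a : ℕ → Letter) :
    Summable fun t : ℕ => (a t).digit / 2 ^ (t + 1) :=
  Summable.of_nonneg_of_le (fun t => div_nonneg (a t).digit_nonneg (by positivity))
    (fun t => by gcongr; exact (a t).digit_le_one) summable_half_pow_succ

theorem binaryValue_eq (a : ℕ → Letter) :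
    binaryValue a = (a 0).digit / 2 + binaryValue (fun t => a (t + 1)) / 2 := by
  unfold binaryValue
  rw [(summable_binaryValue a).tsum_eq_zero_add, ← tsum_div_const]
  congr 1
  · simp
  · refine tsum_congr fun t => ?_
    rw [pow_succ _ (t + 1), div_div]

theorem binaryValue_nonneg (a : ℕ → Letter) : 0 ≤ binaryValue a :=
  tsum_nonneg fun t => div_nonneg (a t).digit_nonneg (by positivity)

theorem binaryValue_le_one (a : ℕ → Letter) : binaryValue a ≤ 1 := by
  have h : ∑' t : ℕ, (1 : ℝ) / 2 ^ (t + 1) = 1 := by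
    have h1 := tsum_geometric_two' 1
    refine (tsum_congr fun t => ?_).trans h1
    rw [pow_succ', div_div]
  rw [← h]
  exact (summable_binaryValue a).tsum_le_tsum
    (fun t => by gcongr; exact (a t).digit_le_one) summable_half_pow_succ

/-- Strictness excludes the tail `yyy…`, whose value 1 causes the ambiguity of dyadic expansions. -/
theorem binaryValue_lt_one (t : ℕ) : ∀ a : ℕ → Letter, a t = Letter.x → binaryValue a < 1 := by
  induction t with
  | zero =>
    intro a h
    have := binaryValue_le_one fun t => a (t + 1)
    rw [binaryValue_eq, h, Letter.digit]
    linarith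
  | succ t ih =>
    intro a h
    have := ih (fun t => a (t + 1)) h
    have h2 := (a 0).digit_le_one
    rw [binaryValue_eq]
    linarith

/-- Both tails have values in `[0, 1)`, so the first digit decides between `[0, 1/2)` and `[1/2,
1)`. -/
theorem head_eq_of_binaryValue_eq {a b : ℕ → Letter} (ha : ∃ t, a (t + 1) = Letter.x)
    (hb : ∃ t, b (t + 1) = Letter.x) (h : binaryValue a = binaryValue b) : a 0 = b 0 := by
  obtain ⟨s, hs⟩ := ha
  obtain ⟨t, ht⟩ := hb
  have h1 := binaryValue_lt_one s (fun t => a (t + 1)) hs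
  have h2 := binaryValue_lt_one t (fun t => b (t + 1)) ht
  have h3 := binaryValue_nonneg fun t => a (t + 1)
  have h4 := binaryValue_nonneg fun t => b (t + 1)
  rw [binaryValue_eq a, binaryValue_eq b] at h
  cases ea : a 0 <;> cases eb : b 0 <;> simp only [ea, eb, Letter.digit] at h ⊢ <;> linarith

/-- Infinitely many letters `x` rule out coincidences such as `0.0111… = 0.1000…`; the digits are
then read off one by one under doubling. -/
theorem eq_of_binaryValue_eq (t : ℕ) : ∀ a b : ℕ → Letter,
    (∀ m, ∃ t, a (m + t) = Letter.x) → (∀ m, ∃ t, b (m + t) = Letter.x) →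
    binaryValue a = binaryValue b → a t = b t := by
  have shift : ∀ a : ℕ → Letter, (∀ m, ∃ t, a (m + t) = Letter.x) →
      ∃ t, a (t + 1) = Letter.x := fun a ha => by
    obtain ⟨t, ht⟩ := ha 1
    exact ⟨t, by rwa [add_comm]⟩
  induction t with
  | zero => exact fun a b ha hb h => head_eq_of_binaryValue_eq (shift a ha) (shift b hb) h
  | succ t ih =>
    intro a b ha hb h
    have h0 := head_eq_of_binaryValue_eq (shift a ha) (shift b hb) h
    refine ih (fun t => a (t + 1)) (fun t => b (t + 1)) (fun m => ?_) (fun m => ?_) ?_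
    · obtain ⟨t, ht⟩ := ha (m + 1)
      exact ⟨t, by rw [← ht]; congr 1; ring⟩
    · obtain ⟨t, ht⟩ := hb (m + 1)
      exact ⟨t, by rw [← ht]; congr 1; ring⟩
    · rw [binaryValue_eq a, binaryValue_eq b, h0] at h
      linarith

/-! ## Periodic words -/

theorem List.getElem?_flatMap_range {α : Type*} (b : ℕ → List α) (n j t : ℕ) (hj : j < n)
    (ht : t < (b j).length) :
    ((List.range n).flatMap b)[(∑ q ∈ Finset.range j, (b q).length) + t]? = (b j)[t]? := by
  have hlen : ∀ n, ((List.range n).flatMap b).length = ∑ q ∈ Finset.range n, (b q).length := by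
    intro n
    induction n with
    | zero => simp
    | succ n ih => rw [List.range_succ, List.flatMap_append, List.length_append, ih,
        Finset.sum_range_succ]; simp
  induction n with
  | zero => omega
  | succ n ih =>
    rw [List.range_succ, List.flatMap_append]
    rcases Nat.lt_succ_iff_lt_or_eq.mp hj with h | rfl
    · rw [List.getElem?_append_left, ih h]
      rw [hlen]
      have : ∑ q ∈ Finset.range (j + 1), (b q).length ≤ ∑ q ∈ Finset.range n, (b q).length :=
        Finset.sum_le_sum_of_subset (Finset.range_mono h)
      rw [Finset.sum_range_succ] at this
      omega
    · rw [List.getElem?_append_right (by rw [hlen]; omega), hlen]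
      simp

theorem List.eq_flatten_replicate {α : Type*} (g m : ℕ) : ∀ w : List α, w.length = m * g →
    (∀ q, q + g < w.length → w[q + g]? = w[q]?) →
    w = (List.replicate m (w.take g)).flatten := by
  induction m with
  | zero => intro w hw _; simpa using hw
  | succ m ih =>
    intro w hw hp
    rw [List.replicate_succ, List.flatten_cons]
    conv_lhs => rw [← List.take_append_drop g w]
    congr 1
    have hl : (w.drop g).length = m * g := by
      rw [List.length_drop, hw, Nat.succ_mul]; omega
    refine (ih (w.drop g) hl fun q hq => ?_).trans ?_
    · rw [List.length_drop] at hq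
      rw [List.getElem?_drop, List.getElem?_drop, ← hp (g + q) (by omega), add_assoc]
    -- If a further block remains, periodicity identifies its first `g` letters with those of `w`;
    -- otherwise there is nothing to compare.
    · rcases Nat.eq_zero_or_pos m with rfl | hm
      · simp
      · congr 2
        refine List.ext_getElem? fun q => ?_
        rw [List.getElem?_take, List.getElem?_take]
        split_ifs with h
        · rw [List.getElem?_drop, ← hp q, add_comm]
          have : 1 * g ≤ m * g := Nat.mul_le_mul_right g hm
          rw [hw, Nat.succ_mul]
          omega
        · rfl

/-- Bézout: the gcd is an integer combination of the two periods. -/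
theorem Function.Periodic.int_gcd {α : Type*} {f : ℤ → α} {p q : ℤ} (hp : f.Periodic p)
    (hq : f.Periodic q) : f.Periodic (Int.gcd p q : ℤ) := by
  rw [Int.gcd_eq_gcd_ab, mul_comm p, mul_comm q]
  exact (hp.int_mul _).add_period (hq.int_mul _)

namespace CodeWords

variable (W : CodeWords)

theorem card_index : Fintype.card W.Index = W.nbar := by
  rw [Fintype.card_sigma]
  exact Finset.sum_congr rfl fun r _ => ZMod.card _

/-- The base index that follows cyclically in the same word. -/
def next (i : W.Index) : W.Index := ⟨i.1, i.2 + 1⟩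

theorem next_injective : Function.Injective W.next := by
  rintro ⟨r, i⟩ ⟨s, j⟩ h
  obtain ⟨rfl, h⟩ := Sigma.mk.inj_iff.mp h
  simpa using h

theorem codeWord_eq (r : Fin W.c) : W.codeWord r = (List.range (W.n r)).flatMap fun j : ℕ =>
    List.replicate (W.k r (j : ZMod (W.n r))) Letter.x ++
      List.replicate (W.l r (j : ZMod (W.n r))) Letter.y := by
  rw [codeWord, List.flatMap_def, List.ofFn_eq_map, ← List.map_coe_finRange_eq_range,
    List.map_map]
  rfl

theorem length_codeWord (r : Fin W.c) : (W.codeWord r).length =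
    ∑ j ∈ Finset.range (W.n r), (W.k r (j : ZMod (W.n r)) + W.l r (j : ZMod (W.n r))) := by
  simp [codeWord, Finset.sum_range, List.sum_ofFn, Function.comp_def]

theorem lettersBefore_add_le (i : W.Index) :
    W.lettersBefore i + (W.k i.1 i.2 + W.l i.1 i.2) ≤ (W.codeWord i.1).length := by
  have h : ∑ j ∈ Finset.range (i.2.val + 1),
      (W.k i.1 (j : ZMod (W.n i.1)) + W.l i.1 (j : ZMod (W.n i.1))) ≤
      (W.codeWord i.1).length := by
    rw [length_codeWord]
    exact Finset.sum_le_sum_of_subset (Finset.range_mono (ZMod.val_lt i.2))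
  rwa [Finset.sum_range_succ, ZMod.natCast_zmod_val] at h

theorem length_codeWord_pos (r : Fin W.c) : 0 < (W.codeWord r).length := by
  have h := W.lettersBefore_add_le ⟨r, 0⟩
  have h1 := W.k_pos r 0
  dsimp only at h
  omega

theorem getElem?_codeWord (i : W.Index) (t : ℕ) (ht : t < W.k i.1 i.2 + W.l i.1 i.2) :
    (W.codeWord i.1)[W.lettersBefore i + t]? =
      (List.replicate (W.k i.1 i.2) Letter.x ++ List.replicate (W.l i.1 i.2) Letter.y)[t]? := by
  have h := List.getElem?_flatMap_range (fun j : ℕ =>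
    List.replicate (W.k i.1 (j : ZMod (W.n i.1))) Letter.x ++
      List.replicate (W.l i.1 (j : ZMod (W.n i.1))) Letter.y) (W.n i.1) i.2.val t
      (ZMod.val_lt i.2) (by simpa using ht)
  rw [← codeWord_eq] at h
  simpa [lettersBefore] using h

theorem getElem?_codeWord_of_lt (r : Fin W.c) {m : ℕ} (hm : m < (W.codeWord r).length) :
    (W.codeWord r)[m]? = some (W.letterAt r m) := by
  rw [letterAt, Nat.mod_eq_of_lt hm, List.getD_eq_getElem?_getD, List.getElem?_eq_getElem hm]
  rfl

theorem letterAt_x (i : W.Index) {t : ℕ} (ht : t < W.k i.1 i.2) :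
    W.letterAt i.1 (W.lettersBefore i + t) = Letter.x := by
  have hle := W.lettersBefore_add_le i
  have h := W.getElem?_codeWord i t (by omega)
  rw [W.getElem?_codeWord_of_lt _ (by omega), List.getElem?_append_left (by simpa using ht),
    List.getElem?_replicate, if_pos ht] at h
  exact Option.some.inj h

theorem letterAt_y (i : W.Index) {t : ℕ} (ht : t < W.l i.1 i.2) :
    W.letterAt i.1 (W.lettersBefore i + W.k i.1 i.2 + t) = Letter.y := by
  have hle := W.lettersBefore_add_le i
  have h := W.getElem?_codeWord i (W.k i.1 i.2 + t) (by omega)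
  rw [W.getElem?_codeWord_of_lt _ (by omega), List.getElem?_append_right (by simp),
    List.getElem?_replicate, if_pos (by simpa using ht), ← add_assoc] at h
  exact Option.some.inj h

theorem letterAt_congr (r : Fin W.c) {m m' : ℕ} (h : m ≡ m' [MOD (W.codeWord r).length]) :
    W.letterAt r m = W.letterAt r m' := by
  rw [letterAt, letterAt, h]

/-- Only a congruence holds, because the successor of the last subscript is the first one, preceded
by no letters. -/
theorem lettersBefore_next (i : W.Index) :
    W.lettersBefore i + W.k i.1 i.2 + W.l i.1 i.2 ≡ W.lettersBefore (W.next i)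
      [MOD (W.codeWord i.1).length] := by
  have h : W.lettersBefore i + W.k i.1 i.2 + W.l i.1 i.2 = ∑ j ∈ Finset.range (i.2.val + 1),
      (W.k i.1 (j : ZMod (W.n i.1)) + W.l i.1 (j : ZMod (W.n i.1))) := by
    rw [Finset.sum_range_succ, ZMod.natCast_zmod_val, lettersBefore, add_assoc]
  rw [h]
  have hv : (i.2 + 1).val = (i.2.val + 1) % W.n i.1 := by
    rw [ZMod.val_add, ZMod.val_one_eq_one_mod, Nat.add_mod_mod]
  simp only [lettersBefore, next, hv]
  rcases (Nat.succ_le_of_lt (ZMod.val_lt i.2)).lt_or_eq with hlt | heq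
  · rw [Nat.mod_eq_of_lt hlt]
    rfl
  · rw [Nat.succ_eq_add_one] at heq
    rw [heq, ← length_codeWord, Nat.mod_self, Finset.range_zero, Finset.sum_empty]
    simp [Nat.ModEq]

theorem exists_letterAt_x (r : Fin W.c) (m : ℕ) : ∃ t, W.letterAt r (m + t) = Letter.x := by
  have hp := W.length_codeWord_pos r
  -- This moves position `m` to a multiple of the word length, where the word starts over with an
  -- `x`.
  refine ⟨m * ((W.codeWord r).length - 1), ?_⟩
  rw [← W.letterAt_x ⟨r, 0⟩ (W.k_pos r 0)]
  refine W.letterAt_congr r ?_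
  have h1 : m + m * ((W.codeWord r).length - 1) = m * (W.codeWord r).length := by
    obtain ⟨p, hp⟩ := Nat.exists_eq_succ_of_ne_zero hp.ne'
    rw [hp, Nat.succ_sub_one, Nat.mul_succ, add_comm]
  simp [h1, lettersBefore, Nat.ModEq]

/-! ## Branch points -/

theorem branchPoint_eq_binaryValue (r : Fin W.c) (m : ℕ) :
    W.branchPoint r m = binaryValue fun t => W.letterAt r (m + t) := rfl

theorem branchPoint_eq (r : Fin W.c) (m : ℕ) :
    W.branchPoint r m = (W.letterAt r m).digit / 2 + W.branchPoint r (m + 1) / 2 := by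
  rw [branchPoint_eq_binaryValue, binaryValue_eq, branchPoint_eq_binaryValue]
  congr 3
  ext t
  congr 1
  ring

theorem branchPoint_congr (r : Fin W.c) {m m' : ℕ} (h : m ≡ m' [MOD (W.codeWord r).length]) :
    W.branchPoint r m = W.branchPoint r m' := by
  simp only [branchPoint_eq_binaryValue, W.letterAt_congr r (h.add_right _)]

/-- The return map doubles at each letter `x`. -/
theorem branchPoint_add_k (i : W.Index) {t : ℕ} (ht : t ≤ W.k i.1 i.2) :
    W.branchPoint i.1 (W.lettersBefore i) =
      W.branchPoint i.1 (W.lettersBefore i + t) / 2 ^ t := by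
  induction t with
  | zero => simp
  | succ t ih =>
    rw [ih (by omega), branchPoint_eq, W.letterAt_x i (by omega), Letter.digit, pow_succ]
    rw [← add_assoc]
    field_simp
    ring

theorem two_mul_xTurnStart (i : W.Index) :
    2 * W.xTurnStart i = W.branchPoint i.1 (W.lettersBefore i + W.k i.1 i.2) := by
  have h := W.k_pos i.1 i.2
  rw [xTurnStart, branchPoint_eq, W.letterAt_x i (by omega), add_assoc, Nat.sub_add_cancel h,
    Letter.digit]
  ring

/-- The last `x` of a block is followed by a `y`, so the binary expansion begins with `01`. -/
theorem xTurnStart_mem (i : W.Index) : W.xTurnStart i ∈ Set.Icc (1 / 4 : ℝ) (1 / 2) := by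
  have h := W.two_mul_xTurnStart i
  have h1 := W.letterAt_y i (W.l_pos i.1 i.2)
  rw [add_zero] at h1
  have h2 := W.branchPoint_eq i.1 (W.lettersBefore i + W.k i.1 i.2)
  rw [h1, Letter.digit] at h2
  have h3 := binaryValue_nonneg fun t =>
    W.letterAt i.1 (W.lettersBefore i + W.k i.1 i.2 + 1 + t)
  have h4 := binaryValue_le_one fun t => W.letterAt i.1 (W.lettersBefore i + W.k i.1 i.2 + t)
  rw [← branchPoint_eq_binaryValue] at h3 h4
  constructor <;> linarith

/-- After the digit 1 of the last `y` come the digits of the next `x`-block, and its start is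
obtained from its last turn by halving. -/
theorem yTurnStart_eq (i : W.Index) : W.yTurnStart i =
    1 / 2 + W.xTurnStart (W.next i) / 2 ^ W.k (W.next i).1 (W.next i).2 := by
  have h := W.l_pos i.1 i.2
  have h1 := W.branchPoint_add_k (W.next i) le_rfl
  rw [yTurnStart, branchPoint_eq, W.letterAt_y i (by omega), Letter.digit, add_assoc _ _ 1,
    Nat.sub_add_cancel h, W.branchPoint_congr _ (W.lettersBefore_next i)]
  rw [← two_mul_xTurnStart] at h1
  change 1 / 2 + W.branchPoint (W.next i).1 _ / 2 = _
  rw [h1]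
  ring

/-- For exponent `k` the summand after `1/2` lies in the window from `2^(-k)/4` to `2^(-k)/2`.
Windows of different exponents meet at most in an end point, so a strict inequality compares
exponents first and positions within the window second. -/
theorem yTurnStart_lt (i j : W.Index) (h : W.yTurnStart i < W.yTurnStart j) :
    W.k (W.next j).1 (W.next j).2 < W.k (W.next i).1 (W.next i).2 ∨
      W.k (W.next j).1 (W.next j).2 = W.k (W.next i).1 (W.next i).2 ∧
        W.xTurnStart (W.next i) < W.xTurnStart (W.next j) := by
  rw [yTurnStart_eq, yTurnStart_eq, add_lt_add_iff_left] at h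
  have hi := W.xTurnStart_mem (W.next i)
  have hj := W.xTurnStart_mem (W.next j)
  generalize W.k (W.next j).1 (W.next j).2 = a at *
  generalize W.k (W.next i).1 (W.next i).2 = b at *
  rcases lt_trichotomy a b with hab | rfl | hab
  · exact Or.inl hab
  · exact Or.inr ⟨rfl, (div_lt_div_iff_of_pos_right (by positivity)).mp h⟩
  · exfalso
    -- With `b < a`, the top of the window of `a` is at most the bottom of the window of `b`.
    have h1 : W.xTurnStart (W.next j) / 2 ^ a ≤ (1 / 2) / 2 ^ (b + 1) := by
      gcongr
      · exact hj.2
      · norm_num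
      · exact hab
    have h2 : (1 / 4 : ℝ) / 2 ^ b ≤ W.xTurnStart (W.next i) / 2 ^ b := by
      gcongr
      exact hi.1
    have h3 : (1 / 2 : ℝ) / 2 ^ (b + 1) = (1 / 4) / 2 ^ b := by
      rw [pow_succ]; field_simp; norm_num
    linarith

/-! ## Distinct turns -/

/-- The letters of the bi-infinite periodic word, numbered by the integers. -/
def letterInt (r : Fin W.c) (m : ℤ) : Letter :=
  W.letterAt r (m % (W.codeWord r).length).toNat

theorem letterInt_natCast (r : Fin W.c) (m : ℕ) : W.letterInt r m = W.letterAt r m := by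
  refine W.letterAt_congr r ?_
  rw [← Int.natCast_mod, Int.toNat_natCast]
  exact Nat.mod_modEq _ _

theorem letterInt_periodic (r : Fin W.c) :
    (W.letterInt r).Periodic ((W.codeWord r).length : ℤ) := by
  intro m
  rw [letterInt, letterInt, Int.add_emod_right]

end CodeWords

namespace ModularLink

variable (L : ModularLink)

/-- The gcd of `d` and the length is also a period, so the word is a power of its prefix of that
length; primitivity allows one factor only. -/
theorem length_dvd_of_periodic (r : Fin L.c) {d : ℤ} (hd : (L.letterInt r).Periodic d) :
    ((L.codeWord r).length : ℤ) ∣ d := by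
  have hpos := L.length_codeWord_pos r
  have hg := hd.int_gcd (L.letterInt_periodic r)
  obtain ⟨m, hm⟩ : Int.gcd d (L.codeWord r).length ∣ (L.codeWord r).length := by
    exact_mod_cast Int.gcd_dvd_right d ((L.codeWord r).length : ℤ)
  have h1 : Int.gcd d (L.codeWord r).length ∣ d.natAbs := by
    exact Int.natCast_dvd.mp (Int.gcd_dvd_left d ((L.codeWord r).length : ℤ))
  generalize Int.gcd d (L.codeWord r).length = g at *
  have h := List.eq_flatten_replicate g m (L.codeWord r) (by rw [hm, mul_comm]) fun q hq => by
    rw [L.getElem?_codeWord_of_lt r hq, L.getElem?_codeWord_of_lt r (by omega),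
      ← L.letterInt_natCast, ← L.letterInt_natCast, Nat.cast_add, hg]
  have hm1 := L.primitive r _ _ h
  rw [hm1, mul_one] at hm
  rw [hm]
  exact Int.natCast_dvd.mpr h1

/-- Equal points give equal letters to the right, and by periodicity in both directions. Each
bi-infinite word then has the length of the other as a period, so the lengths agree and the words
are rotations of each other. Distinctness gives `r = s`, and the remaining shift is a period. -/
theorem eq_of_branchPoint_eq {r s : Fin L.c} {m m' : ℕ}
    (h : L.branchPoint r m = L.branchPoint s m') :
    r = s ∧ ((L.codeWord r).length : ℤ) ∣ (m : ℤ) - m' := by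
  have h0 : ∀ t : ℕ, L.letterInt r (m + t) = L.letterInt s (m' + t) := by
    intro t
    have := eq_of_binaryValue_eq t (fun t => L.letterAt r (m + t)) (fun t => L.letterAt s (m' + t))
      (fun q => by simpa [add_assoc] using L.exists_letterAt_x r (m + q))
      (fun q => by simpa [add_assoc] using L.exists_letterAt_x s (m' + q)) h
    exact_mod_cast (L.letterInt_natCast r (m + t)).trans
      (this.trans (L.letterInt_natCast s (m' + t)).symm)
  have hpr := L.length_codeWord_pos r
  have hps := L.length_codeWord_pos s
  have h1 : ∀ t : ℤ, L.letterInt r (m + t) = L.letterInt s (m' + t) := by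
    intro t
    -- A common period; adding it `|t|` times makes the argument nonnegative.
    set P : ℤ := (L.codeWord r).length * (L.codeWord s).length with hP
    have hP1 : 1 ≤ P := by rw [hP]; exact_mod_cast Nat.mul_pos hpr hps
    have hr : (L.letterInt r).Periodic P := by
      rw [hP, mul_comm]; exact (L.letterInt_periodic r).int_mul _
    have hs : (L.letterInt s).Periodic P := (L.letterInt_periodic s).int_mul _
    have ht : 0 ≤ t + |t| * P := by nlinarith [neg_abs_le t, abs_nonneg t]
    have := h0 (t + |t| * P).toNat
    rw [Int.toNat_of_nonneg ht, ← add_assoc, ← add_assoc] at this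
    have hr1 := hr.int_mul |t| (m + t)
    have hs1 := hs.int_mul |t| (m' + t)
    rw [Int.cast_id] at hr1 hs1
    rwa [hr1, hs1] at this
  have h2 : ∀ t : ℤ, L.letterInt r t = L.letterInt s (m' - m + t) := fun t => by
    have := h1 (t - m)
    rw [add_sub_cancel] at this
    rw [this]
    congr 1
    ring
  have hrs : (L.letterInt r).Periodic ((L.codeWord s).length : ℤ) := fun t => by
    rw [h2, h2, ← add_assoc, L.letterInt_periodic s]
  have hsr : (L.letterInt s).Periodic ((L.codeWord r).length : ℤ) := fun t => by
    have h3 : ∀ t, L.letterInt s t = L.letterInt r (m - m' + t) := fun t => by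
      rw [h2]; congr 1; ring
    rw [h3, h3, ← add_assoc, L.letterInt_periodic r]
  have hlen : (L.codeWord r).length = (L.codeWord s).length :=
    Nat.dvd_antisymm (Int.natCast_dvd_natCast.mp (L.length_dvd_of_periodic r hrs))
      (Int.natCast_dvd_natCast.mp (L.length_dvd_of_periodic s hsr))
  have heq : r = s := by
    refine L.distinct r s ⟨(((m : ℤ) - m') % (L.codeWord r).length).toNat, ?_⟩
    refine List.ext_getElem (by simpa using hlen) fun t ht1 ht2 => ?_
    rw [List.getElem_rotate]
    apply Option.some.inj
    rw [← List.getElem?_eq_getElem, ← List.getElem?_eq_getElem,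
      L.getElem?_codeWord_of_lt r (Nat.mod_lt _ hpr), L.getElem?_codeWord_of_lt s ht2,
      ← L.letterInt_natCast s, ← L.letterInt_natCast, h2]
    unfold CodeWords.letterInt
    congr 2
    push_cast
    rw [Int.toNat_of_nonneg (Int.emod_nonneg _ (by omega)), ← hlen]
    refine congrArg Int.toNat (Int.ModEq.eq ?_)
    rw [← ZMod.intCast_eq_intCast_iff]
    simp
    ring
  subst heq
  refine ⟨rfl, L.length_dvd_of_periodic r fun t => ?_⟩
  rw [h2]
  congr 1
  ring

theorem lettersBefore_lt (r : Fin L.c) (i j : ZMod (L.n r)) (h : i.val < j.val) :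
    L.lettersBefore ⟨r, i⟩ + (L.k r i + L.l r i) ≤ L.lettersBefore ⟨r, j⟩ := by
  have h1 : ∑ q ∈ Finset.range (i.val + 1), (L.k r (q : ZMod (L.n r)) + L.l r (q : ZMod (L.n r)))
      ≤ L.lettersBefore ⟨r, j⟩ := Finset.sum_le_sum_of_subset (Finset.range_mono h)
  rwa [Finset.sum_range_succ, ZMod.natCast_zmod_val] at h1

theorem index_eq_of_branchPoint_eq {i j : L.Index} {a b : ℕ}
    (ha : a < L.k i.1 i.2 + L.l i.1 i.2) (hb : b < L.k j.1 j.2 + L.l j.1 j.2)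
    (h : L.branchPoint i.1 (L.lettersBefore i + a) = L.branchPoint j.1 (L.lettersBefore j + b)) :
    i = j := by
  obtain ⟨r, i⟩ := i
  obtain ⟨s, j⟩ := j
  obtain ⟨h1, h2⟩ := L.eq_of_branchPoint_eq h
  dsimp only at h1 h2 ha hb
  subst h1
  have hi := L.lettersBefore_add_le ⟨r, i⟩
  have hj := L.lettersBefore_add_le ⟨r, j⟩
  dsimp only at hi hj
  -- Both letter numbers lie within one word, so their difference, a multiple of the length, is
  -- zero. The blocks of different subscripts are disjoint.
  have h3 := Int.eq_zero_of_abs_lt_dvd h2 (by rw [abs_lt]; omega)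
  rcases lt_trichotomy i.val j.val with h4 | h4 | h4
  · have := L.lettersBefore_lt r i j h4
    omega
  · rw [ZMod.val_injective _ h4]
  · have := L.lettersBefore_lt r j i h4
    omega

theorem xTurnStart_injective : Function.Injective L.xTurnStart := fun i j h => by
  have := L.k_pos i.1 i.2
  have := L.k_pos j.1 j.2
  exact L.index_eq_of_branchPoint_eq (by omega) (by omega) h

theorem yTurnStart_injective : Function.Injective L.yTurnStart := fun i j h => by
  have := L.l_pos i.1 i.2
  have := L.l_pos j.1 j.2
  simp only [CodeWords.yTurnStart, add_assoc] at h
  exact L.index_eq_of_branchPoint_eq (by omega) (by omega) h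

end ModularLink

/-! ## Isotopies can be reversed -/

theorem AmbientIsotopic.symm {X : Type*} [TopologicalSpace X] {K K' : Set X}
    (h : AmbientIsotopic K K') : AmbientIsotopic K' K := by
  obtain ⟨H, hc, h0, h1⟩ := h
  -- Using `H (1 - t) ∘ (H 1)⁻¹` requires continuity of a single inverse only, not of the inverses
  -- jointly in `t`.
  refine ⟨fun t => (H 1).symm.trans (H (unitInterval.symm t)), ?_, fun p => ?_, ?_⟩
  · exact hc.comp ((unitInterval.continuous_symm.comp continuous_fst).prodMk
      ((H 1).symm.continuous.comp continuous_snd))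
  · simp
  · subst h1
    ext p
    simp [h0]

/-! ## Ranks -/

section Rank

variable {ι : Type*} [Finite ι] (f : ι → ℝ)

theorem ncard_le_lt_iff (i j : ι) :
    {q | f q ≤ f i}.ncard < {q | f q ≤ f j}.ncard ↔ f i < f j := by
  constructor
  · intro h
    by_contra hc
    exact absurd (Set.ncard_le_ncard (s := {q | f q ≤ f j}) (t := {q | f q ≤ f i})
      (fun q (hq : f q ≤ f j) => hq.trans (not_lt.mp hc))) (not_le.mpr h)
  · intro h
    refine Set.ncard_lt_ncard ⟨fun q (hq : f q ≤ f i) => hq.trans h.le, fun hc => ?_⟩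
    exact absurd (hc (le_refl (f j))) (not_le.mpr h)

theorem ncard_le_injective (hf : f.Injective) :
    Function.Injective fun i => {q | f q ≤ f i}.ncard := by
  intro i j h
  refine hf (le_antisymm ?_ ?_) <;> rw [← not_lt, ← ncard_le_lt_iff f] <;>
    exact not_lt.mpr (by first | exact h.le | exact h.ge)

end Rank

/-- The set of pairs and its mirror image are disjoint and avoid the diagonal. -/
theorem two_mul_card_filter_lt {ι : Type*} [Fintype ι] (f : ι → ℕ) :
    2 * (Finset.univ.filter fun p : ι × ι => f p.1 < f p.2).card ≤
      Fintype.card ι * Fintype.card ι - Fintype.card ι := by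
  classical
  set P := Finset.univ.filter fun p : ι × ι => f p.1 < f p.2
  have h1 : (P.map (Equiv.prodComm ι ι).toEmbedding).card = P.card := Finset.card_map _
  have h2 : Disjoint P (P.map (Equiv.prodComm ι ι).toEmbedding) := by
    rw [Finset.disjoint_left]
    rintro ⟨i, j⟩ h h'
    simp [P] at h h'
    omega
  rw [two_mul, ← Finset.card_univ, ← Finset.offDiag_card]
  nth_rewrite 2 [← h1]
  rw [← Finset.card_union_of_disjoint h2]
  refine Finset.card_le_card ?_
  rintro ⟨i, j⟩ h
  simp [P] at h ⊢
  rintro rfl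
  simp at h

/-! ## Piecewise linear curves -/

/-- The intervals between consecutive integers form a locally finite closed cover, and the affine
pieces agree at the integers. -/
theorem continuous_lineMap_floor {E : Type*} [AddCommGroup E] [Module ℝ E] [TopologicalSpace E]
    [IsTopologicalAddGroup E] [ContinuousSMul ℝ E] (v : ℤ → E) :
    Continuous fun t : ℝ => AffineMap.lineMap (v ⌊t⌋) (v (⌊t⌋ + 1)) (Int.fract t) := by
  have hlf : LocallyFinite fun m : ℤ => Set.Icc (m : ℝ) (m + 1) := by
    intro t
    refine ⟨Set.Ioo (t - 1) (t + 1), Ioo_mem_nhds (by linarith) (by linarith),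
      (Set.finite_Icc (⌊t⌋ - 2) (⌊t⌋ + 2)).subset ?_⟩
    rintro m ⟨u, ⟨h1, h2⟩, h3, h4⟩
    have h5 := Int.floor_le t
    have h6 := Int.lt_floor_add_one t
    have h7 : (m : ℝ) < (⌊t⌋ + 2 : ℤ) := by push_cast; linarith
    have h8 : ((⌊t⌋ - 2 : ℤ) : ℝ) < m := by push_cast; linarith
    exact ⟨(Int.cast_lt.mp h8).le, (Int.cast_lt.mp h7).le⟩
  refine hlf.continuous ?_ (fun m => isClosed_Icc) fun m => ?_
  · refine Set.eq_univ_of_forall fun t => Set.mem_iUnion.mpr ⟨⌊t⌋, Int.floor_le t, ?_⟩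
    exact (Int.lt_floor_add_one t).le
  · have hc : Continuous fun t : ℝ => (AffineMap.lineMap (v m) (v (m + 1)) (t - m) : E) := by
      simp only [AffineMap.lineMap_apply_module']
      fun_prop
    refine hc.continuousOn.congr fun t ht => ?_
    rcases ht.2.lt_or_eq with h | h
    · have hm : ⌊t⌋ = m := Int.floor_eq_iff.mpr ⟨ht.1, h⟩
      simp only [Int.fract, hm]
    · have hm : ⌊t⌋ = m + 1 := by rw [h]; simp
      have hf : Int.fract t = 0 := by rw [Int.fract, hm, h]; simp
      simp only [hf, hm]
      simp [h]

/-! ## The sides of the parent link -/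

/-- The sides of the polygons: a horizontal `x`-segment, a vertical `x`-segment, a horizontal
`y`-segment or a vertical `y`-segment. -/
inductive Side where
  | bottom : Side
  | right : Side
  | top : Side
  | left : Side

/-- The horizontal sides. -/
def Side.IsHorizontal : Side → Prop
  | .bottom => True
  | .right => False
  | .top => True
  | .left => False

namespace CodeWords

variable (W : CodeWords)

/-- The points of the sides of the parent link, with parameter in `[0, 1]`. -/
def sidePoint : Side → W.Index → ℝ → ℂ × ℝ
  | .bottom, i, s => (⟨W.xLeft i + s * (W.xRight i - W.xLeft i), W.xLevel i⟩, 1)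
  | .right, i, s => (⟨W.xRight i, W.xLevel i + s * (W.yLevel i - W.xLevel i)⟩, 1 - s)
  | .top, i, s => (⟨W.xRight i + s * (W.xLeft (W.next i) - W.xRight i), W.yLevel i⟩, 0)
  | .left, i, s =>
    (⟨W.xLeft (W.next i), W.yLevel i + s * (W.xLevel (W.next i) - W.yLevel i)⟩, s)

/-- The directions of the sides of the parent link in the plane. -/
def sideVector : Side → W.Index → ℂ
  | .bottom, i => ⟨W.xRight i - W.xLeft i, 0⟩
  | .right, i => ⟨0, W.yLevel i - W.xLevel i⟩
  | .top, i => ⟨W.xLeft (W.next i) - W.xRight i, 0⟩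
  | .left, i => ⟨0, W.xLevel (W.next i) - W.yLevel i⟩

theorem sidePoint_fst (e : Side) (i : W.Index) (s : ℝ) :
    (W.sidePoint e i s).1 = (W.sidePoint e i 0).1 + s • W.sideVector e i := by
  cases e <;> apply Complex.ext <;> simp [sidePoint, sideVector]

/-- The kind of the side number `m` of a component. -/
def sideAt (m : ℤ) : Side :=
  if m % 4 = 0 then .bottom else if m % 4 = 1 then .right else if m % 4 = 2 then .top else .left

/-- The index of the side number `m` of the component `r`. -/
def indexAt (r : Fin W.c) (m : ℤ) : W.Index := ⟨r, ((m / 4 : ℤ) : ZMod (W.n r))⟩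

theorem lineMap_vertex (r : Fin W.c) (m : ℤ) (s : ℝ) :
    AffineMap.lineMap (W.vertex r m) (W.vertex r (m + 1)) s =
      W.sidePoint (sideAt m) (W.indexAt r m) s := by
  have h4 : m % 4 = 0 ∨ m % 4 = 1 ∨ m % 4 = 2 ∨ m % 4 = 3 := by omega
  rcases h4 with h | h | h | h
  · have h1 : (m + 1) % 4 = 1 := by omega
    have h2 : (m + 1) / 4 = m / 4 := by omega
    simp only [vertex, sideAt, indexAt, next, sidePoint, h, h1, h2]
    refine Prod.ext (Complex.ext ?_ ?_) ?_ <;>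
      simp [AffineMap.lineMap_apply_module', add_comm]
  · have h1 : (m + 1) % 4 = 2 := by omega
    have h2 : (m + 1) / 4 = m / 4 := by omega
    simp only [vertex, sideAt, indexAt, next, sidePoint, h, h1, h2]
    refine Prod.ext (Complex.ext ?_ ?_) ?_ <;>
      (simp [AffineMap.lineMap_apply_module']; try ring)
  · have h1 : (m + 1) % 4 = 3 := by omega
    have h2 : (m + 1) / 4 = m / 4 := by omega
    simp only [vertex, sideAt, indexAt, next, sidePoint, h, h1, h2]
    refine Prod.ext (Complex.ext ?_ ?_) ?_ <;>
      simp [AffineMap.lineMap_apply_module', add_comm]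
  · have h1 : (m + 1) % 4 = 0 := by omega
    have h2 : (m + 1) / 4 = m / 4 + 1 := by omega
    simp only [vertex, sideAt, indexAt, next, sidePoint, h, h1, h2]
    refine Prod.ext (Complex.ext ?_ ?_) ?_ <;>
      (simp [AffineMap.lineMap_apply_module']; try ring)

theorem polygon_eq (r : Fin W.c) (t : ℝ) :
    W.polygon r t = W.sidePoint (sideAt ⌊4 * W.n r * t⌋) (W.indexAt r ⌊4 * W.n r * t⌋)
      (Int.fract (4 * W.n r * t)) :=
  W.lineMap_vertex r _ _

theorem continuous_polygon (r : Fin W.c) : Continuous (W.polygon r) :=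
  (continuous_lineMap_floor (W.vertex r)).comp (continuous_const.mul continuous_id)

theorem polygon_periodic (r : Fin W.c) : (W.polygon r).Periodic 1 := by
  intro t
  have h : (4 * W.n r * (t + 1) : ℝ) = 4 * W.n r * t + (4 * W.n r : ℤ) := by push_cast; ring
  have h1 : ∀ m : ℤ, sideAt (m + 4 * W.n r) = sideAt m := fun m => by
    simp only [sideAt, Int.add_mul_emod_self_left]
  have h2 : ∀ m : ℤ, W.indexAt r (m + 4 * W.n r) = W.indexAt r m := fun m => by
    simp [indexAt, Int.add_mul_ediv_left]
  rw [polygon_eq, polygon_eq, h, Int.floor_add_intCast, Int.fract_add_intCast, h1, h2]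

/-! ## Positions of the segments -/

theorem xRank_lt_iff (i j : W.Index) :
    W.xRank i < W.xRank j ↔ W.xTurnStart i < W.xTurnStart j :=
  ncard_le_lt_iff W.xTurnStart i j

theorem yRank_lt_iff (i j : W.Index) :
    W.yRank i < W.yRank j ↔ W.yTurnStart i < W.yTurnStart j :=
  ncard_le_lt_iff W.yTurnStart i j

theorem xRank_mem (i : W.Index) : W.xRank i ∈ Set.Icc 1 W.nbar := by
  constructor
  · exact (Set.ncard_pos).mpr ⟨i, le_refl (W.xTurnStart i)⟩
  · rw [← card_index, ← Nat.card_eq_fintype_card]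
    exact Set.ncard_le_card _

theorem yRank_mem (i : W.Index) : W.yRank i ∈ Set.Icc 1 W.nbar := by
  constructor
  · exact (Set.ncard_pos).mpr ⟨i, le_refl (W.yTurnStart i)⟩
  · rw [← card_index, ← Nat.card_eq_fintype_card]
    exact Set.ncard_le_card _

theorem xLevel_mem (i : W.Index) : W.xLevel i ∈ Set.Icc (-W.nbar : ℝ) (-1) := by
  obtain ⟨h1, h2⟩ := W.xRank_mem i
  have h1' : (1 : ℝ) ≤ W.xRank i := by exact_mod_cast h1
  have h2' : (W.xRank i : ℝ) ≤ W.nbar := by exact_mod_cast h2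
  constructor <;> rw [xLevel] <;> linarith

theorem yLevel_mem (i : W.Index) : W.yLevel i ∈ Set.Icc (1 : ℝ) W.nbar := by
  obtain ⟨h1, h2⟩ := W.yRank_mem i
  have h1' : (1 : ℝ) ≤ W.yRank i := by exact_mod_cast h1
  have h2' : (W.yRank i : ℝ) ≤ W.nbar := by exact_mod_cast h2
  constructor <;> rw [yLevel] <;> linarith

theorem xLevel_lt_iff {i j : W.Index} : W.xLevel i < W.xLevel j ↔ W.xRank i < W.xRank j := by
  simp [xLevel]

theorem yLevel_lt_iff {i j : W.Index} : W.yLevel i < W.yLevel j ↔ W.yRank j < W.yRank i := by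
  simp [yLevel]

/-- Since the extension is strictly between 0 and 1, each vertical segment lies strictly between
integer abscissas, hence off all annuli. -/
theorem extension_mem (i : W.Index) :
    ((W.nbar + 1) - (W.xRank i : ℝ)) / (W.nbar + 1) ∈ Set.Ioo (0 : ℝ) 1 := by
  obtain ⟨h1, h2⟩ := W.xRank_mem i
  have h1' : (1 : ℝ) ≤ W.xRank i := by exact_mod_cast h1
  have h2' : (W.xRank i : ℝ) ≤ W.nbar := by exact_mod_cast h2
  have h3 : (0 : ℝ) < W.nbar + 1 := by positivity
  constructor
  · apply div_pos _ h3; linarith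
  · rw [div_lt_one h3]; linarith

theorem xLeft_mem (i : W.Index) :
    W.xLeft i ∈ Set.Ioo (-(W.k i.1 i.2 + 1) : ℝ) (-(W.k i.1 i.2)) := by
  have h := W.extension_mem i
  constructor <;> rw [xLeft] <;> linarith [h.1, h.2]

theorem xRight_mem (i : W.Index) :
    W.xRight i ∈ Set.Ioo (W.l i.1 i.2 : ℝ) (W.l i.1 i.2 + 1) := by
  have h := W.extension_mem i
  constructor <;> rw [xRight] <;> linarith [h.1, h.2]

theorem xLeft_neg (i : W.Index) : W.xLeft i < 0 :=
  (W.xLeft_mem i).2.trans_le (neg_nonpos.mpr (Nat.cast_nonneg _))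

theorem xRight_pos (i : W.Index) : 0 < W.xRight i :=
  (Nat.cast_nonneg _).trans_lt (W.xRight_mem i).1

theorem xLeft_lt {i j : W.Index} (h : W.k j.1 j.2 < W.k i.1 i.2 ∨
    W.k j.1 j.2 = W.k i.1 i.2 ∧ W.xRank i < W.xRank j) : W.xLeft i < W.xLeft j := by
  rcases h with h | ⟨h, h'⟩
  · have h1 : (W.k j.1 j.2 : ℝ) + 1 ≤ W.k i.1 i.2 := by exact_mod_cast h
    linarith [(W.xLeft_mem i).2, (W.xLeft_mem j).1]
  · have h1 : (W.xRank i : ℝ) < W.xRank j := by exact_mod_cast h'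
    have h2 : (0 : ℝ) < W.nbar + 1 := by positivity
    rw [xLeft, xLeft, h]
    gcongr

theorem xRight_lt {i j : W.Index} (h : W.l i.1 i.2 < W.l j.1 j.2 ∨
    W.l i.1 i.2 = W.l j.1 j.2 ∧ W.xRank j < W.xRank i) : W.xRight i < W.xRight j := by
  rcases h with h | ⟨h, h'⟩
  · have h1 : (W.l i.1 i.2 : ℝ) + 1 ≤ W.l j.1 j.2 := by exact_mod_cast h
    linarith [(W.xRight_mem i).2, (W.xRight_mem j).1]
  · have h1 : (W.xRank j : ℝ) < W.xRank i := by exact_mod_cast h'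
    have h2 : (0 : ℝ) < W.nbar + 1 := by positivity
    rw [xRight, xRight, h]
    gcongr

/-! ### The drawing fits into the punctured disc -/

theorem scale_bounds (i : W.Index) :
    (W.k i.1 i.2 : ℝ) + W.l i.1 i.2 + W.nbar + 3 ≤ W.scale := by
  have h := Finset.single_le_sum (f := fun i : W.Index => (W.k i.1 i.2 : ℝ) + W.l i.1 i.2)
    (fun _ _ => by positivity) (Finset.mem_univ i)
  rw [scale]
  linarith

theorem scale_pos : 0 < W.scale := by
  rw [scale]
  positivity

theorem div_scale_inj {z w : ℂ} : z / W.scale = w / W.scale ↔ z = w :=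
  div_left_inj' (by exact_mod_cast W.scale_pos.ne')

theorem abs_lineMap_le {a b c : ℝ} (ha : |a| ≤ c) (hb : |b| ≤ c) {s : ℝ}
    (hs : s ∈ Set.Ico (0 : ℝ) 1) : |a + s * (b - a)| ≤ c := by
  rw [abs_le] at *
  obtain ⟨h0, h1⟩ := hs
  constructor <;> nlinarith

theorem abs_xLeft_le (i : W.Index) : |W.xLeft i| ≤ W.scale - W.nbar - 1 := by
  have h := W.scale_bounds i
  have h1 := W.xLeft_mem i
  have h2 : (0 : ℝ) ≤ W.l i.1 i.2 := by positivity
  rw [abs_le]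
  constructor <;> linarith [h1.1, W.xLeft_neg i]

theorem abs_xRight_le (i : W.Index) : |W.xRight i| ≤ W.scale - W.nbar - 1 := by
  have h := W.scale_bounds i
  have h1 := W.xRight_mem i
  have h2 : (0 : ℝ) ≤ W.k i.1 i.2 := by positivity
  rw [abs_le]
  constructor <;> linarith [h1.2, W.xRight_pos i]

theorem abs_xLevel_le (i : W.Index) : |W.xLevel i| ≤ W.nbar := by
  have h := W.xLevel_mem i
  rw [abs_le]
  constructor <;> linarith [h.1, h.2]

theorem abs_yLevel_le (i : W.Index) : |W.yLevel i| ≤ W.nbar := by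
  have h := W.yLevel_mem i
  rw [abs_le]
  constructor <;> linarith [h.1, h.2]

theorem norm_sidePoint_div_scale_lt_one (e : Side) (i : W.Index) {s : ℝ}
    (hs : s ∈ Set.Ico (0 : ℝ) 1) : ‖(W.sidePoint e i s).1 / W.scale‖ < 1 := by
  have h := W.scale_pos
  rw [norm_div, Complex.norm_real, Real.norm_of_nonneg h.le, div_lt_one h]
  have h1 : |(W.sidePoint e i s).1.re| ≤ W.scale - W.nbar - 1 := by
    cases e
    · exact abs_lineMap_le (W.abs_xLeft_le _) (W.abs_xRight_le _) hs
    · exact W.abs_xRight_le _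
    · exact abs_lineMap_le (W.abs_xRight_le _) (W.abs_xLeft_le _) hs
    · exact W.abs_xLeft_le _
  have h2 : |(W.sidePoint e i s).1.im| ≤ W.nbar := by
    cases e
    · exact W.abs_xLevel_le _
    · exact abs_lineMap_le (W.abs_xLevel_le _) (W.abs_yLevel_le _) hs
    · exact W.abs_yLevel_le _
    · exact abs_lineMap_le (W.abs_yLevel_le _) (W.abs_xLevel_le _) hs
  linarith [Complex.norm_le_abs_re_add_abs_im (W.sidePoint e i s).1]

/-- Punctures have integer abscissas and levels 0 or `±(nbar + 1)`; horizontal sides avoid these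
levels, vertical sides avoid integer abscissas. -/
theorem div_scale_notMem_punctures {z : ℂ}
    (h : (z.im ∈ Set.Icc (-W.nbar : ℝ) (-1) ∨ z.im ∈ Set.Icc (1 : ℝ) W.nbar) ∨
      (∃ i, z.re = W.xLeft i) ∨ ∃ i, z.re = W.xRight i) : z / W.scale ∉ W.punctures := by
  rintro ⟨j, hj⟩
  simp only [div_scale_inj] at hj
  have hk : (0 : ℝ) ≤ W.k j.1 j.2 := by positivity
  have hl : (0 : ℝ) ≤ W.l j.1 j.2 := by positivity
  rcases h with h | ⟨i, h⟩ | ⟨i, h⟩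
  · rcases hj with rfl | rfl | rfl | rfl <;> rcases h with h | h <;> dsimp only at h <;>
      linarith [h.1, h.2]
  · have h1 := W.xLeft_mem i
    have h2 := W.xLeft_neg i
    rw [← h] at h1 h2
    rcases hj with rfl | rfl | rfl | rfl <;> dsimp only at h1 h2
    · have h3 : ((W.k i.1 i.2 : ℕ) : ℝ) < W.k j.1 j.2 := by linarith [h1.2]
      have h4 : (W.k j.1 j.2 : ℝ) < (W.k i.1 i.2 + 1 : ℕ) := by push_cast; linarith [h1.1]
      rw [Nat.cast_lt] at h3 h4
      omega
    · have h3 : ((W.k i.1 i.2 : ℕ) : ℝ) < W.k j.1 j.2 := by linarith [h1.2]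
      have h4 : (W.k j.1 j.2 : ℝ) < (W.k i.1 i.2 + 1 : ℕ) := by push_cast; linarith [h1.1]
      rw [Nat.cast_lt] at h3 h4
      omega
    · linarith
    · linarith
  · have h1 := W.xRight_mem i
    have h2 := W.xRight_pos i
    rw [← h] at h1 h2
    rcases hj with rfl | rfl | rfl | rfl <;> dsimp only at h1 h2
    · linarith
    · linarith
    · have h3 : ((W.l i.1 i.2 : ℕ) : ℝ) < W.l j.1 j.2 := by linarith [h1.1]
      have h4 : (W.l j.1 j.2 : ℝ) < (W.l i.1 i.2 + 1 : ℕ) := by push_cast; linarith [h1.2]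
      rw [Nat.cast_lt] at h3 h4
      omega
    · have h3 : ((W.l i.1 i.2 : ℕ) : ℝ) < W.l j.1 j.2 := by linarith [h1.1]
      have h4 : (W.l j.1 j.2 : ℝ) < (W.l i.1 i.2 + 1 : ℕ) := by push_cast; linarith [h1.2]
      rw [Nat.cast_lt] at h3 h4
      omega

theorem sidePoint_div_scale_notMem_punctures (e : Side) (i : W.Index) (s : ℝ) :
    (W.sidePoint e i s).1 / W.scale ∉ W.punctures := by
  apply div_scale_notMem_punctures
  cases e
  · exact Or.inl (Or.inl (W.xLevel_mem i))
  · exact Or.inr (Or.inr ⟨i, rfl⟩)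
  · exact Or.inl (Or.inr (W.yLevel_mem i))
  · exact Or.inr (Or.inl ⟨W.next i, rfl⟩)

theorem sidePoint_height_mem (e : Side) (i : W.Index) {s : ℝ} (hs : s ∈ Set.Ico (0 : ℝ) 1) :
    (W.sidePoint e i s).2 ∈ Set.Icc (0 : ℝ) 1 := by
  obtain ⟨h0, h1⟩ := hs
  cases e <;> simp only [sidePoint, Set.mem_Icc] <;> constructor <;> linarith

theorem sideVector_ne_zero (e : Side) (i : W.Index) : W.sideVector e i ≠ 0 := by
  intro h
  have hre := congrArg Complex.re h
  have him := congrArg Complex.im h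
  have h1 := W.xLeft_neg i
  have h2 := W.xLeft_neg (W.next i)
  have h3 := W.xRight_pos i
  have h4 := (W.xLevel_mem i).2
  have h5 := (W.xLevel_mem (W.next i)).2
  have h6 := (W.yLevel_mem i).1
  cases e <;> simp only [sideVector, Complex.zero_re, Complex.zero_im] at hre him <;> linarith

theorem sideVector_im_eq_zero {e : Side} (he : e.IsHorizontal) (i : W.Index) :
    (W.sideVector e i).im = 0 := by
  cases e <;> simp_all [sideVector, Side.IsHorizontal]

theorem sideVector_re_eq_zero {e : Side} (he : ¬ e.IsHorizontal) (i : W.Index) :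
    (W.sideVector e i).re = 0 := by
  cases e <;> simp_all [sideVector, Side.IsHorizontal]

/-! ## The parent link in the Seifert-fibred space -/

theorem lift_mem {p : ℂ × ℝ} (h1 : ‖p.1 / W.scale‖ < 1) (h2 : p.1 / W.scale ∉ W.punctures) :
    W.lift p ∈ ThreeSphere \ W.sfLink := by
  have h3 : 0 < 1 - ‖p.1 / W.scale‖ ^ 2 := by nlinarith [norm_nonneg (p.1 / W.scale)]
  refine ⟨?_, ?_⟩
  · change ‖_ * _‖ ^ 2 + ‖p.1 / W.scale‖ ^ 2 = 1
    rw [norm_mul, Complex.norm_exp_ofReal_mul_I, mul_one, Complex.norm_real, Real.norm_eq_abs,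
      sq_abs, Real.sq_sqrt h3.le]
    ring
  · rintro (⟨-, h⟩ | h)
    · have h' : ((Real.sqrt (1 - ‖p.1 / W.scale‖ ^ 2) : ℂ) * Complex.exp (p.2 * Complex.I)) = 0 := h
      rw [mul_eq_zero, Complex.ofReal_eq_zero] at h'
      exact h'.elim (Real.sqrt_pos.mpr h3).ne' (Complex.exp_ne_zero _)
    · simp only [Set.mem_iUnion] at h
      obtain ⟨z, hz, -, h⟩ := h
      exact h2 (by rwa [show p.1 / W.scale = z from h])

/-- Heights in `[0, 1]` are principal arguments, so the argument of the first coordinate recovers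
them. -/
theorem lift_inj {p q : ℂ × ℝ} (hp : ‖p.1 / W.scale‖ < 1) (hp2 : p.2 ∈ Set.Icc (0 : ℝ) 1)
    (hq2 : q.2 ∈ Set.Icc (0 : ℝ) 1) (h : W.lift p = W.lift q) : p = q := by
  obtain ⟨h1, h2⟩ := Prod.ext_iff.mp h
  have h2' : p.1 = q.1 := W.div_scale_inj.mp h2
  refine Prod.ext h2' ?_
  have h3 : 0 < Real.sqrt (1 - ‖p.1 / W.scale‖ ^ 2) :=
    Real.sqrt_pos.mpr (by nlinarith [norm_nonneg (p.1 / W.scale)])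
  simp only [lift, ← h2'] at h1
  have h4 := congrArg Complex.arg h1
  have hpi := Real.pi_gt_three
  rwa [Complex.exp_mul_I, Complex.exp_mul_I, Complex.arg_mul_cos_add_sin_mul_I h3,
    Complex.arg_mul_cos_add_sin_mul_I h3] at h4
  · constructor <;> linarith [hq2.1, hq2.2]
  · constructor <;> linarith [hp2.1, hp2.2]

theorem fract_mem_Ico (t : ℝ) : Int.fract t ∈ Set.Ico (0 : ℝ) 1 :=
  ⟨Int.fract_nonneg t, Int.fract_lt_one t⟩

/-- The parametrization of the parent link by the closed polygons. -/
def parentCurve (r : Fin W.c) (t : ℝ) : W.SeifertSpace :=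
  ⟨W.lift (W.polygon r t), by
    rw [polygon_eq]
    exact W.lift_mem (W.norm_sidePoint_div_scale_lt_one _ _ (fract_mem_Ico _))
      (W.sidePoint_div_scale_notMem_punctures _ _ _)⟩

theorem continuous_parentCurve (r : Fin W.c) : Continuous (W.parentCurve r) := by
  refine Continuous.subtype_mk ?_ _
  have h := W.continuous_polygon r
  have h1 : Continuous W.lift := by
    unfold lift
    fun_prop
  exact h1.comp h

theorem parentCurve_periodic (r : Fin W.c) : (W.parentCurve r).Periodic 1 := fun t =>
  Subtype.ext (congrArg W.lift (W.polygon_periodic r t))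

theorem parentLink_eq : W.parentLink = ⋃ r, Set.range (W.parentCurve r) := by
  ext p
  simp only [parentLink, Set.mem_ofPred_eq, Set.mem_iUnion, Set.mem_range, parentCurve,
    Subtype.ext_iff, eq_comm]

theorem projCurve_parentCurve (r : Fin W.c) (t : ℝ) :
    W.projCurve W.parentCurve r t = (W.polygon r t).1 / W.scale := rfl

/-! ### Numbering and velocity of the sides -/

theorem eq_of_sideAt_eq_of_indexAt_eq {r s : Fin W.c} {m m' : ℤ}
    (hm : m ∈ Set.Ico 0 (4 * W.n r : ℤ)) (hm' : m' ∈ Set.Ico 0 (4 * W.n s : ℤ))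
    (h1 : sideAt m = sideAt m') (h2 : W.indexAt r m = W.indexAt s m') : r = s ∧ m = m' := by
  obtain ⟨rfl, h3⟩ := Sigma.mk.inj_iff.mp h2
  refine ⟨rfl, ?_⟩
  rw [heq_eq_eq, ZMod.intCast_eq_intCast_iff, Int.ModEq, Int.emod_eq_of_lt, Int.emod_eq_of_lt]
    at h3
  · have h4 : m % 4 = m' % 4 := by
      unfold sideAt at h1
      split_ifs at h1 <;> omega
    omega
  all_goals simp only [Set.mem_Ico] at hm hm'; omega

theorem floor_mem_Ico (r : Fin W.c) {t : ℝ} (ht : t ∈ Set.Ico (0 : ℝ) 1) :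
    ⌊4 * W.n r * t⌋ ∈ Set.Ico 0 (4 * W.n r : ℤ) := by
  have hn : (0 : ℝ) < W.n r := by exact_mod_cast NeZero.pos (W.n r)
  refine ⟨Int.floor_nonneg.mpr (mul_nonneg (by positivity) ht.1), Int.floor_lt.mpr ?_⟩
  push_cast
  nlinarith [ht.2]

/-- The projection of a side is traversed with constant velocity. -/
theorem projCurve_eventuallyEq (r : Fin W.c) {t : ℝ} (ht : Int.fract (4 * W.n r * t) ≠ 0) :
    W.projCurve W.parentCurve r =ᶠ[nhds t] fun u =>
      ((W.sidePoint (sideAt ⌊4 * W.n r * t⌋) (W.indexAt r ⌊4 * W.n r * t⌋) 0).1 +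
        (4 * W.n r * u - ⌊4 * W.n r * t⌋ : ℝ) •
          W.sideVector (sideAt ⌊4 * W.n r * t⌋) (W.indexAt r ⌊4 * W.n r * t⌋)) / W.scale := by
  have hc : ContinuousAt (fun u : ℝ => 4 * W.n r * u) t := by fun_prop
  have h1 : (⌊4 * W.n r * t⌋ : ℝ) < 4 * W.n r * t :=
    lt_of_le_of_ne (Int.floor_le _) fun h => ht (by rw [Int.fract, h, sub_self])
  have h2 := Int.lt_floor_add_one (4 * W.n r * t)
  filter_upwards [hc (Ioo_mem_nhds h1 h2)] with u hu
  have hu' : ⌊4 * W.n r * u⌋ = ⌊4 * W.n r * t⌋ := Int.floor_eq_iff.mpr ⟨hu.1.le, hu.2⟩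
  rw [projCurve_parentCurve, polygon_eq, sidePoint_fst, Int.fract, hu']

theorem deriv_projCurve (r : Fin W.c) {t : ℝ} (ht : Int.fract (4 * W.n r * t) ≠ 0) :
    deriv (W.projCurve W.parentCurve r) t = (4 * W.n r / W.scale : ℝ) •
      W.sideVector (sideAt ⌊4 * W.n r * t⌋) (W.indexAt r ⌊4 * W.n r * t⌋) := by
  rw [(W.projCurve_eventuallyEq r ht).deriv_eq]
  have h1 : HasDerivAt (fun u : ℝ => 4 * W.n r * u - ⌊4 * W.n r * t⌋) (4 * W.n r) t := by
    simpa using ((hasDerivAt_id t).const_mul (4 * W.n r : ℝ)).sub_const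
      (⌊4 * W.n r * t⌋ : ℝ)
  have h2 := (((h1.smul_const (W.sideVector (sideAt ⌊4 * W.n r * t⌋)
    (W.indexAt r ⌊4 * W.n r * t⌋))).const_add
      (W.sidePoint (sideAt ⌊4 * W.n r * t⌋) (W.indexAt r ⌊4 * W.n r * t⌋) 0).1).div_const
        (W.scale : ℂ)).deriv
  rw [h2, Complex.real_smul, Complex.real_smul]
  push_cast
  ring

theorem velocity_ne_zero (r : Fin W.c) : (4 * W.n r / W.scale : ℝ) ≠ 0 := by
  have hn : (0 : ℝ) < W.n r := by exact_mod_cast NeZero.pos (W.n r)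
  have := W.scale_pos
  positivity

theorem isImmersedAt_parentCurve (r : Fin W.c) {t : ℝ} (ht : Int.fract (4 * W.n r * t) ≠ 0) :
    W.IsImmersedAt W.parentCurve r t := by
  constructor
  · refine ContDiffAt.congr_of_eventuallyEq ?_ (W.projCurve_eventuallyEq r ht)
    fun_prop
  · rw [deriv_projCurve _ _ ht]
    exact smul_ne_zero (W.velocity_ne_zero r) (W.sideVector_ne_zero _ _)

theorem finite_corners (r : Fin W.c) :
    {t ∈ Set.Ico (0 : ℝ) 1 | ¬ W.IsImmersedAt W.parentCurve r t}.Finite := by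
  refine ((Set.finite_Ico (0 : ℤ) (4 * W.n r)).image fun m : ℤ => (m : ℝ) / (4 * W.n r)).subset ?_
  rintro t ⟨ht, h⟩
  refine ⟨⌊4 * W.n r * t⌋, W.floor_mem_Ico r ht, ?_⟩
  have h1 : Int.fract (4 * W.n r * t) = 0 := by
    by_contra hc
    exact h (W.isImmersedAt_parentCurve r hc)
  have hn : (0 : ℝ) < W.n r := by exact_mod_cast NeZero.pos (W.n r)
  have h2 := Int.floor_add_fract (4 * W.n r * t)
  rw [h1, add_zero] at h2
  dsimp only
  rw [h2]
  field_simp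

end CodeWords

namespace CodeWords

variable (W : CodeWords)

/-! ## Crossings -/

/-- The crossing of the vertical `x_i`-segment with the horizontal `x_j`-segment. -/
def crossXX (p : W.Index × W.Index) : ℂ := ⟨W.xRight p.1, W.xLevel p.2⟩

/-- The crossing of the vertical `y`-segment ending at the `x_i`-segment with the horizontal
`x_j`-segment. -/
def crossYX (p : W.Index × W.Index) : ℂ := ⟨W.xLeft p.1, W.xLevel p.2⟩

/-- The crossing of the vertical `x_i`-segment with the horizontal `y_j`-segment. -/
def crossXY (p : W.Index × W.Index) : ℂ := ⟨W.xRight p.1, W.yLevel p.2⟩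

/-- The positions in the plane where two sides may cross. -/
def crossings : Set ℂ :=
  W.crossXX '' {p | W.xRank p.1 < W.xRank p.2} ∪ W.crossYX '' {p | W.xRank p.1 < W.xRank p.2} ∪
    W.crossXY '' {p | W.yRank p.1 < W.yRank p.2}

theorem finite_crossings : W.crossings.Finite :=
  (((Set.toFinite _).image _).union ((Set.toFinite _).image _)).union ((Set.toFinite _).image _)

theorem two_mul_ncard_rank_lt (f : W.Index → ℕ) :
    2 * {p : W.Index × W.Index | f p.1 < f p.2}.ncard ≤ W.nbar * W.nbar - W.nbar := by
  classical
  have h : {p : W.Index × W.Index | f p.1 < f p.2} =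
      (Finset.univ.filter fun p : W.Index × W.Index => f p.1 < f p.2 :) := by
    ext; simp
  rw [h, Set.ncard_coe_finset, ← card_index]
  exact two_mul_card_filter_lt f

theorem two_mul_ncard_crossings : 2 * W.crossings.ncard ≤ 3 * (W.nbar * W.nbar - W.nbar) := by
  have h1 := Set.ncard_image_le (f := W.crossXX) (s := {p | W.xRank p.1 < W.xRank p.2})
    (Set.toFinite _)
  have h2 := Set.ncard_image_le (f := W.crossYX) (s := {p | W.xRank p.1 < W.xRank p.2})
    (Set.toFinite _)
  have h3 := Set.ncard_image_le (f := W.crossXY) (s := {p | W.yRank p.1 < W.yRank p.2})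
    (Set.toFinite _)
  have h4 := Set.ncard_union_le (W.crossXX '' {p | W.xRank p.1 < W.xRank p.2})
    (W.crossYX '' {p | W.xRank p.1 < W.xRank p.2})
  have h5 := Set.ncard_union_le (W.crossXX '' {p | W.xRank p.1 < W.xRank p.2} ∪
    W.crossYX '' {p | W.xRank p.1 < W.xRank p.2}) (W.crossXY '' {p | W.yRank p.1 < W.yRank p.2})
  have h6 := W.two_mul_ncard_rank_lt W.xRank
  have h7 := W.two_mul_ncard_rank_lt W.yRank
  rw [crossings]
  omega

end CodeWords

/-! ### Which sides of the parent link cross -/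

namespace ModularLink

variable (L : ModularLink)

theorem xRank_injective : Function.Injective L.xRank :=
  ncard_le_injective _ L.xTurnStart_injective

theorem yRank_injective : Function.Injective L.yRank :=
  ncard_le_injective _ L.yTurnStart_injective

theorem xLevel_injective : Function.Injective L.xLevel := fun i j h =>
  L.xRank_injective (by simpa [CodeWords.xLevel] using h)

theorem yLevel_injective : Function.Injective L.yLevel := fun i j h =>
  L.yRank_injective (by simpa [CodeWords.yLevel] using h)

theorem xLeft_injective : Function.Injective L.xLeft := by
  intro i j h
  by_contra hne
  rcases lt_trichotomy (L.k i.1 i.2) (L.k j.1 j.2) with h1 | h1 | h1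
  · exact (L.xLeft_lt (Or.inl h1)).ne' h
  · rcases (L.xRank_injective.ne hne).lt_or_gt with h2 | h2
    · exact (L.xLeft_lt (Or.inr ⟨h1.symm, h2⟩)).ne h
    · exact (L.xLeft_lt (Or.inr ⟨h1, h2⟩)).ne' h
  · exact (L.xLeft_lt (Or.inl h1)).ne h

theorem xRight_injective : Function.Injective L.xRight := by
  intro i j h
  by_contra hne
  rcases lt_trichotomy (L.l i.1 i.2) (L.l j.1 j.2) with h1 | h1 | h1
  · exact (L.xRight_lt (Or.inl h1)).ne h
  · rcases (L.xRank_injective.ne hne).lt_or_gt with h2 | h2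
    · exact (L.xRight_lt (Or.inr ⟨h1.symm, h2⟩)).ne' h
    · exact (L.xRight_lt (Or.inr ⟨h1, h2⟩)).ne h
  · exact (L.xRight_lt (Or.inl h1)).ne' h

/-- A higher `y`-segment reaches further to the left. -/
theorem xLeft_next_lt {i j : L.Index} (h : L.yLevel i < L.yLevel j) :
    L.xLeft (L.next j) < L.xLeft (L.next i) := by
  rw [L.yLevel_lt_iff, L.yRank_lt_iff] at h
  -- The order within the `y`-bunch is the order in which the left ends are placed: by exponent,
  -- then by `x`-rank.
  refine L.xLeft_lt ((L.yTurnStart_lt j i h).imp_right fun h => ⟨h.1, ?_⟩)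
  exact (L.xRank_lt_iff _ _).mpr h.2

/-- Parallel sides of the same kind lie on different lines by injectivity of levels and abscissas;
those of different kinds are separated by the sign of the level or of the abscissa. -/
theorem sidePoint_fst_injective_of_iff {e f : Side} (hef : e.IsHorizontal ↔ f.IsHorizontal)
    {i j : L.Index} {s t : ℝ} (h : (L.sidePoint e i s).1 = (L.sidePoint f j t).1) :
    e = f ∧ i = j ∧ s = t := by
  have hre := congrArg Complex.re h
  have him := congrArg Complex.im h
  have a1 := L.xLeft_neg i
  have a2 := L.xLeft_neg (L.next i)
  have a3 := L.xRight_pos i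
  have a4 := (L.xLevel_mem i).2
  have a5 := (L.xLevel_mem (L.next i)).2
  have a6 := (L.yLevel_mem i).1
  have b2 := L.xLeft_neg (L.next j)
  have b3 := L.xRight_pos j
  have b4 := (L.xLevel_mem j).2
  have b6 := (L.yLevel_mem j).1
  cases e <;> cases f <;> simp only [Side.IsHorizontal, iff_true, iff_false, not_true] at hef <;>
    simp only [CodeWords.sidePoint] at hre him
  · obtain rfl := L.xLevel_injective him
    exact ⟨rfl, rfl, mul_right_cancel₀ (by linarith : L.xRight i - L.xLeft i ≠ 0)
      (add_left_cancel hre)⟩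
  · linarith
  · obtain rfl := L.xRight_injective hre
    exact ⟨rfl, rfl, mul_right_cancel₀ (sub_pos.mpr (by linarith)).ne' (add_left_cancel him)⟩
  · linarith
  · linarith
  · obtain rfl := L.yLevel_injective him
    exact ⟨rfl, rfl, mul_right_cancel₀ (sub_neg.mpr (by linarith)).ne (add_left_cancel hre)⟩
  · linarith
  · obtain rfl := L.next_injective (L.xLeft_injective hre)
    exact ⟨rfl, rfl, mul_right_cancel₀ (sub_neg.mpr (by linarith)).ne (add_left_cancel him)⟩

/-- Parameters in `[0, 1)` assign each corner to the side that starts there. Consecutive sides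
therefore do not meet, and `0 < s`, `0 < t` place every crossing away from the corners. -/
theorem sidePoint_fst_crossing {e f : Side} (he : e.IsHorizontal) (hf : ¬ f.IsHorizontal)
    {i j : L.Index} {s t : ℝ} (hs : s ∈ Set.Ico (0 : ℝ) 1) (ht : t ∈ Set.Ico (0 : ℝ) 1)
    (h : (L.sidePoint e i s).1 = (L.sidePoint f j t).1) :
    0 < s ∧ 0 < t ∧ (L.sidePoint e i s).1 ∈ L.crossings := by
  obtain ⟨hs0, hs1⟩ := hs
  obtain ⟨ht0, ht1⟩ := ht
  have hre := congrArg Complex.re h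
  have him := congrArg Complex.im h
  have a1 := L.xLeft_neg i
  have a2 := L.xLeft_neg (L.next i)
  have a3 := L.xRight_pos i
  have a4 := (L.xLevel_mem i).2
  have a6 := (L.yLevel_mem i).1
  have b2 := L.xLeft_neg (L.next j)
  have b3 := L.xRight_pos j
  have b4 := (L.xLevel_mem j).2
  have b5 := (L.xLevel_mem (L.next j)).2
  have b6 := (L.yLevel_mem j).1
  -- A side with distinct ends does not reach its end point for `s < 1`.
  have key : ∀ {a b : ℝ}, a ≠ b → a + s * (b - a) ≠ b := fun {a b} hab h => by
    have h1 : (1 - s) * (b - a) = 0 := by linear_combination -h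
    rcases mul_eq_zero.mp h1 with h2 | h2
    · linarith
    · exact hab (by linarith)
  cases e <;> cases f <;> simp only [Side.IsHorizontal, not_true] at he hf <;>
    simp only [CodeWords.sidePoint] at hre him
  · have hij : i ≠ j := by
      rintro rfl
      exact key (a1.trans a3).ne hre
    have ht' : 0 < t := ht0.lt_of_ne' (by
      rintro rfl
      rw [zero_mul, add_zero] at him
      exact hij (L.xLevel_injective him))
    refine ⟨hs0.lt_of_ne' ?_, ht', Or.inl (Or.inl ⟨(j, i), ?_, ?_⟩)⟩
    · rintro rfl
      linarith
    · refine L.xLevel_lt_iff.mp ?_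
      nlinarith
    · exact Complex.ext hre.symm rfl
  · have hij : i ≠ L.next j := by
      rintro rfl
      have : (1 - t) * (L.yLevel j - L.xLevel (L.next j)) = 0 := by linear_combination -him
      rcases mul_eq_zero.mp this with h2 | h2 <;> linarith
    have ht' : 0 < t := ht0.lt_of_ne' (by
      rintro rfl
      linarith)
    refine ⟨hs0.lt_of_ne' ?_, ht', Or.inl (Or.inr ⟨(L.next j, i), ?_, ?_⟩)⟩
    · rintro rfl
      rw [zero_mul, add_zero] at hre
      exact hij (L.xLeft_injective hre)
    · refine L.xLevel_lt_iff.mp ?_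
      nlinarith
    · exact Complex.ext hre.symm rfl
  · have hij : i ≠ j := by
      rintro rfl
      have : (1 - t) * (L.yLevel i - L.xLevel i) = 0 := by linear_combination him
      rcases mul_eq_zero.mp this with h2 | h2 <;> linarith
    have ht' : 0 < t := ht0.lt_of_ne' (by
      rintro rfl
      linarith)
    refine ⟨hs0.lt_of_ne' ?_, ht', Or.inr ⟨(j, i), ?_, ?_⟩⟩
    · rintro rfl
      rw [zero_mul, add_zero] at hre
      exact hij (L.xRight_injective hre)
    · refine L.yLevel_lt_iff.mp ?_
      nlinarith
    · exact Complex.ext hre.symm rfl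
  -- A vertical `y`-segment starting below the horizontal one never rises to it; one starting above
  -- lies to the left of its left end.
  · exfalso
    have hij : i ≠ j := by
      rintro rfl
      exact key (a2.trans a3).ne' hre
    rcases (L.yLevel_injective.ne hij).lt_or_gt with h1 | h1
    · have := L.xLeft_next_lt h1
      nlinarith
    · nlinarith

/-- Horizontal sides have height 0 or 1, interior points of vertical sides have heights strictly
between. -/
theorem sidePoint_height_ne {e f : Side} (he : e.IsHorizontal) (hf : ¬ f.IsHorizontal)
    {i j : L.Index} {s t : ℝ} (h0 : 0 < t) (h1 : t < 1) :
    (L.sidePoint e i s).2 ≠ (L.sidePoint f j t).2 := by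
  cases e <;> cases f <;> simp only [Side.IsHorizontal, not_true] at he hf <;>
    simp only [CodeWords.sidePoint] <;> intro h <;> linarith

theorem sidePoint_injective {e f : Side} {i j : L.Index} {s t : ℝ} (hs : s ∈ Set.Ico (0 : ℝ) 1)
    (ht : t ∈ Set.Ico (0 : ℝ) 1) (h : L.sidePoint e i s = L.sidePoint f j t) :
    e = f ∧ i = j ∧ s = t := by
  have h1 := congrArg Prod.fst h
  by_cases he : e.IsHorizontal <;> by_cases hf : f.IsHorizontal
  · exact L.sidePoint_fst_injective_of_iff (iff_of_true he hf) h1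
  · have h2 := L.sidePoint_fst_crossing he hf hs ht h1
    exact absurd (congrArg Prod.snd h) (L.sidePoint_height_ne he hf h2.2.1 ht.2)
  · have h2 := L.sidePoint_fst_crossing hf he ht hs h1.symm
    exact absurd (congrArg Prod.snd h).symm (L.sidePoint_height_ne hf he h2.2.1 hs.2)
  · exact L.sidePoint_fst_injective_of_iff (iff_of_false he hf) h1

/-- Over a point of the plane, two different points of the parent link lie on sides of different
directions, and in the interior of these sides. -/
theorem crossing_of_ne {e f : Side} {i j : L.Index} {s t : ℝ} (hs : s ∈ Set.Ico (0 : ℝ) 1)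
    (ht : t ∈ Set.Ico (0 : ℝ) 1) (hne : L.sidePoint e i s ≠ L.sidePoint f j t)
    (h : (L.sidePoint e i s).1 = (L.sidePoint f j t).1) :
    (e.IsHorizontal ↔ ¬ f.IsHorizontal) ∧ 0 < s ∧ 0 < t ∧
      (L.sidePoint e i s).1 ∈ L.crossings := by
  by_cases he : e.IsHorizontal <;> by_cases hf : f.IsHorizontal
  · obtain ⟨rfl, rfl, rfl⟩ := L.sidePoint_fst_injective_of_iff (iff_of_true he hf) h
    exact absurd rfl hne
  · exact ⟨iff_of_true he hf, L.sidePoint_fst_crossing he hf hs ht h⟩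
  · obtain ⟨h1, h2, h3⟩ := L.sidePoint_fst_crossing hf he ht hs h.symm
    exact ⟨iff_of_false he (not_not.mpr hf), h2, h1, h ▸ h3⟩
  · obtain ⟨rfl, rfl, rfl⟩ := L.sidePoint_fst_injective_of_iff (iff_of_false he hf) h
    exact absurd rfl hne

/-! ### Regularity of the projection and the final count -/

theorem isLinkParam_parentCurve : L.IsLinkParam L.parentCurve L.parentLink where
  continuous := L.continuous_parentCurve
  periodic := L.parentCurve_periodic
  range := L.parentLink_eq
  injective r s t ht u hu h := by
    have h1 : L.lift (L.polygon r t) = L.lift (L.polygon s u) := congrArg Subtype.val h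
    rw [L.polygon_eq, L.polygon_eq] at h1
    have h2 := L.lift_inj
      (L.norm_sidePoint_div_scale_lt_one _ _ (CodeWords.fract_mem_Ico _))
      (L.sidePoint_height_mem _ _ (CodeWords.fract_mem_Ico _))
      (L.sidePoint_height_mem _ _ (CodeWords.fract_mem_Ico _)) h1
    obtain ⟨h3, h4, h5⟩ := L.sidePoint_injective (CodeWords.fract_mem_Ico _)
      (CodeWords.fract_mem_Ico _) h2
    obtain ⟨rfl, h6⟩ := L.eq_of_sideAt_eq_of_indexAt_eq (L.floor_mem_Ico r ht)
      (L.floor_mem_Ico s hu) h3 h4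
    refine ⟨rfl, ?_⟩
    have hn : (0 : ℝ) < L.n r := by exact_mod_cast NeZero.pos (L.n r)
    have h7 : 4 * L.n r * t = 4 * L.n r * u := by
      rw [← Int.floor_add_fract (4 * L.n r * t), ← Int.floor_add_fract (4 * L.n r * u), h5, h6]
    exact mul_left_cancel₀ (by positivity) h7

theorem exists_sidePoint_of_mem {p : L.SeifertSpace} (hp : p ∈ L.parentLink) :
    ∃ e i, ∃ s ∈ Set.Ico (0 : ℝ) 1, (p : ℂ × ℂ) = L.lift (L.sidePoint e i s) := by
  obtain ⟨r, t, h⟩ := hp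
  exact ⟨_, _, _, CodeWords.fract_mem_Ico _, h.trans (congrArg L.lift (L.polygon_eq r t))⟩

theorem selfIntersections_subset :
    Subtype.val '' L.selfIntersections L.parentLink ⊆
      (fun z : ℂ => z / L.scale) '' L.crossings := by
  rintro _ ⟨b, ⟨p, hp, q, hq, hne, hpb, hqb⟩, rfl⟩
  obtain ⟨e, i, s, hs, hp'⟩ := L.exists_sidePoint_of_mem hp
  obtain ⟨f, j, t, ht, hq'⟩ := L.exists_sidePoint_of_mem hq
  have h1 : (p : ℂ × ℂ).2 = b := congrArg Subtype.val hpb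
  have h2 : (q : ℂ × ℂ).2 = b := congrArg Subtype.val hqb
  have h3 : (L.sidePoint e i s).1 = (L.sidePoint f j t).1 := by
    rw [← L.div_scale_inj]
    rw [hp'] at h1
    rw [hq'] at h2
    exact h1.trans h2.symm
  have h4 := L.crossing_of_ne hs ht (fun h => hne (Subtype.ext (by rw [hp', hq', h]))) h3
  refine ⟨_, h4.2.2.2, ?_⟩
  rw [← h1, hp']
  rfl

theorem finite_selfIntersections : (L.selfIntersections L.parentLink).Finite :=
  Set.Finite.of_finite_image ((L.finite_crossings.image _).subset L.selfIntersections_subset)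
    Subtype.val_injective.injOn

theorem ncard_selfIntersections_le :
    ((L.selfIntersections L.parentLink).ncard : ℝ) ≤ 3 / 2 * L.nbar * (L.nbar - 1) := by
  have h1 : (L.selfIntersections L.parentLink).ncard ≤ L.crossings.ncard := by
    rw [← Set.ncard_image_of_injective _ Subtype.val_injective]
    exact (Set.ncard_le_ncard L.selfIntersections_subset (L.finite_crossings.image _)).trans
      (Set.ncard_image_le L.finite_crossings)
  have h2 : 2 * (L.selfIntersections L.parentLink).ncard + 3 * L.nbar ≤
      3 * (L.nbar * L.nbar) := by
    have h3 := L.two_mul_ncard_crossings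
    -- This makes the natural-number subtraction `nbar * nbar - nbar` a true one.
    have h4 := Nat.le_mul_self L.nbar
    omega
  have h3 : 2 * ((L.selfIntersections L.parentLink).ncard : ℝ) + 3 * L.nbar ≤
      3 * (L.nbar * L.nbar) := by exact_mod_cast h2
  linarith

theorem isRegularProjection_parentCurve :
    L.IsRegularProjection L.parentCurve L.parentLink where
  corners := L.finite_corners
  finite := L.finite_selfIntersections
  transverse r s t u hne h := by
    have h1 : (L.polygon r t).1 = (L.polygon s u).1 := by
      rw [← L.div_scale_inj]
      exact congrArg Subtype.val h
    have hne' : L.polygon r t ≠ L.polygon s u := fun h =>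
      hne (Subtype.ext (congrArg L.lift h))
    rw [L.polygon_eq, L.polygon_eq] at h1 hne'
    obtain ⟨h2, h3, h4, -⟩ := L.crossing_of_ne (CodeWords.fract_mem_Ico _)
      (CodeWords.fract_mem_Ico _) hne' h1
    refine ⟨L.isImmersedAt_parentCurve r h3.ne', L.isImmersedAt_parentCurve s h4.ne', ?_⟩
    rw [L.deriv_projCurve r h3.ne', L.deriv_projCurve s h4.ne', LinearIndependent.pair_iff]
    have ne1 := L.sideVector_ne_zero (CodeWords.sideAt ⌊4 * L.n r * t⌋)
      (L.indexAt r ⌊4 * L.n r * t⌋)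
    have ne2 := L.sideVector_ne_zero (CodeWords.sideAt ⌊4 * L.n s * u⌋)
      (L.indexAt s ⌊4 * L.n s * u⌋)
    have v1 := L.velocity_ne_zero r
    have v2 := L.velocity_ne_zero s
    intro a b hab
    have hre := congrArg Complex.re hab
    have him := congrArg Complex.im hab
    -- One velocity is horizontal and the other vertical, both nonzero, so the coordinates of the
    -- relation decouple.
    by_cases he : (CodeWords.sideAt ⌊4 * L.n r * t⌋).IsHorizontal
    · have i1 := L.sideVector_im_eq_zero he (L.indexAt r ⌊4 * L.n r * t⌋)
      have i2 := L.sideVector_re_eq_zero (h2.mp he) (L.indexAt s ⌊4 * L.n s * u⌋)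
      have r1 := fun h => ne1 (Complex.ext h i1)
      have r2 := fun h => ne2 (Complex.ext i2 h)
      simp only [Complex.add_re, Complex.add_im, Complex.smul_re, Complex.smul_im, i1, i2,
        smul_eq_mul, mul_zero, add_zero, zero_add, Complex.zero_re, Complex.zero_im,
        mul_eq_zero] at hre him r1 r2
      tauto
    · have i1 := L.sideVector_re_eq_zero he (L.indexAt r ⌊4 * L.n r * t⌋)
      have i2 := L.sideVector_im_eq_zero (not_not.mp fun h => he (h2.mpr h))
        (L.indexAt s ⌊4 * L.n s * u⌋)
      have r1 := fun h => ne1 (Complex.ext i1 h)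
      have r2 := fun h => ne2 (Complex.ext h i2)
      simp only [Complex.add_re, Complex.add_im, Complex.smul_re, Complex.smul_im, i1, i2,
        smul_eq_mul, mul_zero, add_zero, zero_add, Complex.zero_re, Complex.zero_im,
        mul_eq_zero] at hre him r1 r2
      tauto
  double b hb := by
    obtain ⟨p, hp, q, hq, hne, hpb, hqb⟩ := hb
    rw [Set.encard_eq_two]
    refine ⟨p, q, hne, Set.Subset.antisymm ?_ ?_⟩
    · rintro o ⟨ho, hob⟩
      -- Three points over `b` would lie on sides of pairwise different directions, but there are
      -- only two directions.
      by_contra hc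
      simp only [Set.mem_insert_iff, Set.mem_singleton_iff, not_or] at hc
      have key : ∀ {p q : L.SeifertSpace} {e f : Side} {i j : L.Index} {s t : ℝ},
          s ∈ Set.Ico (0 : ℝ) 1 → t ∈ Set.Ico (0 : ℝ) 1 → L.proj p = b → L.proj q = b →
          (p : ℂ × ℂ) = L.lift (L.sidePoint e i s) → (q : ℂ × ℂ) = L.lift (L.sidePoint f j t) →
          p ≠ q → (e.IsHorizontal ↔ ¬ f.IsHorizontal) := by
        intro p q e f i j s t hs ht hpb hqb hp hq hne
        refine (L.crossing_of_ne hs ht (fun h => hne (Subtype.ext (by rw [hp, hq, h]))) ?_).1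
        have h1 : (p : ℂ × ℂ).2 = (q : ℂ × ℂ).2 := congrArg Subtype.val (hpb.trans hqb.symm)
        rw [hp, hq] at h1
        exact L.div_scale_inj.mp h1
      obtain ⟨e, i, s, hs, hp'⟩ := L.exists_sidePoint_of_mem hp
      obtain ⟨f, j, t, ht, hq'⟩ := L.exists_sidePoint_of_mem hq
      obtain ⟨g, k, u, hu, ho'⟩ := L.exists_sidePoint_of_mem ho
      have h1 := key hs ht hpb hqb hp' hq' hne
      have h2 := key hu hs hob hpb ho' hp' hc.1
      have h3 := key hu ht hob hqb ho' hq' hc.2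
      tauto
    · rintro o (rfl | rfl)
      · exact ⟨hp, hpb⟩
      · exact ⟨hq, hqb⟩

end ModularLink

theorem mainTheorem9 (L : ModularLink) (Lp : Set L.SeifertSpace)
    (hLp : AmbientIsotopic L.parentLink Lp) :
    ∃ Lp' : Set L.SeifertSpace, AmbientIsotopic Lp Lp' ∧
      ∃ γ : Fin L.c → ℝ → L.SeifertSpace,
        L.IsLinkParam γ Lp' ∧ L.IsRegularProjection γ Lp' ∧
          ((L.selfIntersections Lp').ncard : ℝ) ≤ 3 / 2 * (L.nbar : ℝ) * ((L.nbar : ℝ) - 1) :=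
  ⟨L.parentLink, hLp.symm, L.parentCurve, L.isLinkParam_parentCurve,
    L.isRegularProjection_parentCurve, L.ncard_selfIntersections_le⟩

end
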